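/- For $\tau=u+iv\in\mathbb H$ let $\Lambda_\tau=\mathbb Z+\mathbb Z\tau$, and for $s\ge 0$ let $\Lambda_\tau(s)=\{\omega^2|\omega|^{2s}:\omega\in\Lambda_\tau\setminus\{0\}\}$ (a set, so that $\omega$ and $-\omega$ give one element). For $k\in\mathbb N_0$ and $s>0$ let $$e_k(\Lambda_\tau(s))=\sum_{\{\omega_1,\dots,\omega_k\}\subset\Lambda_\tau(s)}\frac1{\omega_1\cdots\omega_k},$$ the sum running over all $k$-element subsets of $\Lambda_\tau(s)$, and let $e_k(\Lambda_\tau(0)):=\lim_{s\to0^+}e_k(\Lambda_\tau(s))$. **Theorem 1.1.** The sums $e_k(\Lambda_\tau(s))$, $s>0$, converge absolutely and the limits $e_k(\Lambda_\tau(0))$ exist for all $k\ge 0$ and $\tau\in\mathbb H$. Moreover: (1) For every $k\ge0$, $\tau\mapsto e_k(\Lambda_\tau(0))$ is an almost holomorphic modular form of weight $2k$ and depth $k$ for $\mathrm{SL}_2(\mathbb Z)$: for all $\left(\begin{smallmatrix}a&b\\c&d\end{smallmatrix}\right)\in\mathrm{SL}_2(\mathbb Z)$ we have $e_k(\Lambda_{\frac{a\tau+b}{c\tau+d}}(0))=(c\tau+d)^{2k}e_k(\Lambda_\tau(0))$,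 and $e_k(\Lambda_\tau(0))=\sum_{r=0}^k f_r(\tau)v^{-r}$ with functions $f_r$ that are holomorphic on $\mathbb H$ and bounded as $v\to\infty$, where $f_k\not\equiv0$. (2) We have $e_0(\Lambda_\tau(0))=1$. For $k\ge1$ the function $\tau\mapsto e_k(\Lambda_\tau(0))$ is real differentiable, and with the lowering operator $L=-2iv^2\frac{\partial}{\partial\overline\tau}$, $$L\big(e_k(\Lambda_\tau(0))\big)=\frac\pi2\,e_{k-1}(\Lambda_\tau(0)).$$ (3) The series in $$\phi(z;\tau):=e^{-\frac{\pi z^2}{2v}}\sum_{k\ge0}(-1)^ke_k(\Lambda_\tau(0))z^{2k+1}$$ converges for all $z\in\mathbb C$, $\tau\in\mathbb H$, and $\phi$ is a Jacobi form of weight $-1$ and index $\frac12$, in the following sense. It is holomorphic on $\mathbb C\times\mathbb H$. For all $\left(\begin{smallmatrix}a&b\\c&d\end{smallmatrix}\right)\in\mathrm{SL}_2(\mathbb Z)$ it satisfies $$\phi\left(\tfrac z{c\tau+d};\tfrac{a\tau+b}{c\tau+d}\right)=(c\tau+d)^{-1}e^{\frac{\pi icz^2}{c\tau+d}}\phi(z;\tau).$$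 For some $\varepsilon\in\{0,1\}$ and all $\lambda,\mu\in\mathbb Z$ it satisfies $$\phi(z+\lambda\tau+\mu;\tau)=(-1)^{\mu+\lambda\varepsilon}e^{-\pi i(\lambda^2\tau+2\lambda z)}\phi(z;\tau).$$ It has an absolutely convergent expansion $$\phi(z;\tau)=\sum_{n\ge0,\ r\in\frac12+\mathbb Z}c(n,r)\,e^{2\pi i(n\tau+rz)}$$ with $c(n,r)=0$ unless $r^2\le 2n+\frac14$. Finally, $$\phi(z;\tau)=\frac{\vartheta(z;\tau)}{-2\pi\eta^3(\tau)},\qquad \vartheta(z;\tau)=\sum_{n\in\mathbb Z+\frac12}e^{2\pi in(z+\frac12)}e^{\pi in^2\tau},\qquad \eta(\tau)=e^{\frac{\pi i\tau}{12}}\prod_{n\ge1}(1-e^{2\pi in\tau}).$$ -/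

import Mathlib

open Filter Topology
open scoped UpperHalfPlane MatrixGroups Manifold

noncomputable section

namespace LatticeEisenstein

/-- The lattice `ℤ + ℤτ`. -/
def lattice (τ : ℍ) : Set ℂ := {w | ∃ m n : ℤ, w = m + n * (τ : ℂ)}

/-- The set `{ω² |ω|^{2s} : ω ∈ ℤ + ℤτ, ω ≠ 0}`. As `ω` and `-ω` give the same element, each pair
`±ω` contributes one element. -/
def latticePowers (τ : ℍ) (s : ℝ) : Set ℂ :=
  {x | ∃ w ∈ lattice τ, w ≠ 0 ∧ x = w ^ 2 * ((‖w‖ ^ (2 * s) : ℝ) : ℂ)}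

/-- The product of the reciprocals of the elements of a `k`-element subset `T` of `S`. -/
def reciprocalTerm (S : Set ℂ) (k : ℕ) (T : {T : Finset ℂ // T.card = k ∧ (T : Set ℂ) ⊆ S}) : ℂ :=
  ∏ x ∈ T.1, x⁻¹

/-- The elementary symmetric sum `e_k(S)`: the sum of `1 / (ω₁ ⋯ ω_k)` over all unordered choices
of `k` distinct elements of `S`. -/
def symmSum (S : Set ℂ) (k : ℕ) : ℂ := ∑' T, reciprocalTerm S k T

/-- `e_k(Λ_τ(0))`, the limit of `e_k(Λ_τ(s))` as `s → 0⁺`. -/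
def e (k : ℕ) (τ : ℍ) : ℂ := limUnder (𝓝[>] (0 : ℝ)) fun s ↦ symmSum (latticePowers τ s) k

/-- Almost holomorphic modular forms for `SL(2, ℤ)` of weight `k` and depth exactly `p`:
functions with the weight `k` transformation law that are polynomials of degree `p` in `1 / v`,
`v = Im τ`, whose coefficients are holomorphic on `ℍ` and bounded at `i∞`. -/
def IsAlmostHolomorphicModularForm (k : ℤ) (p : ℕ) (F : ℍ → ℂ) : Prop :=
  (∀ (γ : SL(2, ℤ)) (τ : ℍ), F (γ • τ) = ((γ 1 0 : ℂ) * τ + (γ 1 1 : ℂ)) ^ k * F τ) ∧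
  ∃ f : ℕ → ℍ → ℂ,
    (∀ r, MDifferentiable 𝓘(ℂ) 𝓘(ℂ) (f r)) ∧
    (∀ r, UpperHalfPlane.IsBoundedAtImInfty (f r)) ∧
    f p ≠ 0 ∧
    ∀ τ : ℍ, F τ = ∑ r ∈ Finset.range (p + 1), f r τ * (1 / (τ.im : ℂ)) ^ r

/-- `F` as a function on `ℂ` (only its values on the upper half-plane matter). -/
def extend (F : ℍ → ℂ) : ℂ → ℂ := fun w ↦ F (UpperHalfPlane.ofComplex w)

/-- The Wirtinger derivative `∂/∂τ̄ = (∂/∂u + i ∂/∂v) / 2`, where `τ = u + iv`. -/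
def dbar (F : ℍ → ℂ) (τ : ℍ) : ℂ :=
  (fderiv ℝ (extend F) (τ : ℂ) 1 + Complex.I * fderiv ℝ (extend F) (τ : ℂ) Complex.I) / 2

/-- The lowering operator `L = -2 i v² ∂/∂τ̄`. -/
def lowering (F : ℍ → ℂ) (τ : ℍ) : ℂ := -2 * Complex.I * (τ.im : ℂ) ^ 2 * dbar F τ

/-- Weak Jacobi forms of weight `k` and index `m = M / 2` on `SL(2, ℤ)`, with a sign character
in the elliptic law: holomorphic functions on `ℂ × ℍ` (so without poles in `z`) satisfying the
modular and the elliptic transformation laws, with a Fourier expansion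
`∑ c(n, r) q ^ n ζ ^ r` over integers `n ≥ 0` and `r ∈ m + ℤ` in which
`c(n, r) = 0` unless `r² ≤ 4nm + m²`. Below, `c n l` is the coefficient `c(n, l + m)`. -/
structure IsWeakJacobiForm (k : ℤ) (M : ℕ) (φ : ℂ → ℍ → ℂ) : Prop where
  holomorphic : DifferentiableOn ℂ (fun p : ℂ × ℂ ↦ φ p.1 (UpperHalfPlane.ofComplex p.2))
    {p | 0 < p.2.im}
  modular : ∀ (γ : SL(2, ℤ)) (z : ℂ) (τ : ℍ),
    φ (z / ((γ 1 0 : ℂ) * τ + (γ 1 1 : ℂ))) (γ • τ) =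
      ((γ 1 0 : ℂ) * τ + (γ 1 1 : ℂ)) ^ k *
        Complex.exp (2 * Real.pi * Complex.I * ((M : ℂ) / 2) * (γ 1 0 : ℂ) * z ^ 2 /
          ((γ 1 0 : ℂ) * τ + (γ 1 1 : ℂ))) * φ z τ
  elliptic : ∃ ε : ℤ, (ε = 0 ∨ ε = 1) ∧ ∀ (l μ : ℤ) (z : ℂ) (τ : ℍ),
    φ (z + l * (τ : ℂ) + μ) τ =
      (-1 : ℂ) ^ (M * μ + l * ε) *
        Complex.exp (-2 * Real.pi * Complex.I * ((M : ℂ) / 2) * (l ^ 2 * (τ : ℂ) + 2 * l * z)) *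
          φ z τ
  fourier : ∃ c : ℕ → ℤ → ℂ,
    (∀ (n : ℕ) (l : ℤ), c n l ≠ 0 →
      ((l : ℝ) + (M : ℝ) / 2) ^ 2 ≤ 4 * n * ((M : ℝ) / 2) + ((M : ℝ) / 2) ^ 2) ∧
    ∀ (z : ℂ) (τ : ℍ), HasSum
      (fun p : ℕ × ℤ ↦ c p.1 p.2 * Complex.exp (2 * Real.pi * Complex.I * p.1 * (τ : ℂ)) *
        Complex.exp (2 * Real.pi * Complex.I * ((p.2 : ℂ) + (M : ℂ) / 2) * z)) (φ z τ)

/-- The `k`-th term of the generating series `∑ (-1) ^ k e_k(Λ_τ(0)) z ^ (2k + 1)`. -/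
def generatingTerm (z : ℂ) (τ : ℍ) (k : ℕ) : ℂ := (-1) ^ k * e k τ * z ^ (2 * k + 1)

/-- `φ(z; τ) = exp(-π z² / (2v)) ∑ (-1) ^ k e_k(Λ_τ(0)) z ^ (2k + 1)`. -/
def phi (z : ℂ) (τ : ℍ) : ℂ :=
  Complex.exp (-(Real.pi * z ^ 2 / (2 * (τ.im : ℂ)))) * ∑' k, generatingTerm z τ k

/-- The Jacobi theta function `∑_{n ∈ ℤ + 1/2} exp(2πi n (z + 1/2)) q ^ (n² / 2)`,
`q = exp(2πi τ)`. -/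
def theta (z : ℂ) (τ : ℍ) : ℂ :=
  ∑' n : ℤ, Complex.exp (2 * Real.pi * Complex.I * ((n : ℂ) + 1 / 2) * (z + 1 / 2)) *
    Complex.exp (2 * Real.pi * Complex.I * (τ : ℂ) * (((n : ℂ) + 1 / 2) ^ 2 / 2))

end LatticeEisenstein

end

/-! For s > 0 the reciprocals of the points ω²|ω|^{2s}, one for each pair ±ω, are absolutely
summable, so (-1)^k e_k is Newton's universal polynomial `newtonSeq` in their power sums. As formal
series, ∑ newtonSeq p k X^k = exp(-∑ p_i X^{i+1}/(i+1)). Two facts follow: limits of e_k reduce to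
limits of power sums (`tendsto_newtonSeq`), and adding power sums multiplies generating series
(`newtonSeq_add`).

As s → 0⁺ the higher power sums converge by domination. The first one is borderline and is handled
by Hecke's trick: each row of the lattice is compared with its integral. The differences are
O(|ω|⁻³) uniformly in s, and in the limit they give ½G₂ in Eisenstein's order of summation. The
integrals carry a factor s, which meets the pole of ζ(1+2s) and leaves -π/(2v)
(`tendsto_tsum_rowIntegral`). So the limiting power sums are holomorphic Eisenstein series except
for the summand -π/(2v) in the first one. That summand multiplies the generating series by
exp(πX/(2v)), hence e_k is a polynomial of degree k in 1/v with explicit coefficients (`e_eq_sum`).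
The lowering operator differentiates only the powers of 1/v, which gives (2). Weight 2k comes from
the homogeneity of the lattice (`latticePowers_smul`).

At X = z² the Gaussian in φ cancels exp(πz²/(2v)), leaving z exp(-½G₂z²) ∏(1 - z²/ω²)exp(z²/ω²)
(`phi_eq_mul_tprod`). Evaluated row by row with Euler's sine product, this is the product side of
the Jacobi triple product, so φ = ϑ/(-2πη³). The modular law of φ comes from that of the e_k. The
elliptic law, holomorphy and the Fourier expansion are read off from ϑ and η. -/

noncomputable section

namespace LatticeEisenstein

/-! ### Newton's identities as a differential equation for power series -/

/-- The sequence attached to a sequence of power sums by Newton's identities; `p j` plays the role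
of the `(j + 1)`-st power sum, and `newtonSeq p k` that of `(-1) ^ k` times the `k`-th elementary
symmetric function. -/
def newtonSeq (p : ℕ → ℂ) : ℕ → ℂ
  | 0 => 1
  | k + 1 => -(∑ i : Fin (k + 1), p i * newtonSeq p (k - i)) / (k + 1)

lemma newtonSeq_zero (p : ℕ → ℂ) : newtonSeq p 0 = 1 := by rw [newtonSeq]

lemma newtonSeq_succ (p : ℕ → ℂ) (k : ℕ) :
    newtonSeq p (k + 1) =
      -(∑ i ∈ Finset.range (k + 1), p i * newtonSeq p (k - i)) / (k + 1) := by
  rw [newtonSeq, ← Fin.sum_univ_eq_sum_range (fun i ↦ p i * newtonSeq p (k - i))]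

-- Newton's recursion is the coefficient form of f' = -P f. Together with constant term 1 this
-- equation determines f (`eq_mk_newtonSeq`), so identities between such sequences can be checked as
-- differential equations.
open PowerSeries in
lemma derivative_mk_newtonSeq (p : ℕ → ℂ) :
    d⁄dX ℂ (PowerSeries.mk (newtonSeq p)) = -(PowerSeries.mk p * PowerSeries.mk (newtonSeq p)) := by
  ext k
  rw [coeff_derivative, coeff_mk, map_neg, coeff_mul, newtonSeq_succ,
    Finset.Nat.sum_antidiagonal_eq_sum_range_succ_mk]
  simp only [coeff_mk]
  have : (k : ℂ) + 1 ≠ 0 := by exact_mod_cast Nat.succ_ne_zero k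
  field_simp

open PowerSeries in
lemma eq_mk_newtonSeq {p : ℕ → ℂ} {f : PowerSeries ℂ} (h0 : constantCoeff f = 1)
    (hf : d⁄dX ℂ f = -(PowerSeries.mk p * f)) : f = PowerSeries.mk (newtonSeq p) := by
  ext k
  rw [coeff_mk]
  induction k using Nat.strong_induction_on with
  | _ k ih =>
    cases k with
    | zero => rw [newtonSeq_zero, coeff_zero_eq_constantCoeff_apply, h0]
    | succ k =>
      have hk : (k : ℂ) + 1 ≠ 0 := by exact_mod_cast Nat.succ_ne_zero k
      have := congrArg (coeff k) hf
      rw [coeff_derivative, map_neg, coeff_mul,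
        Finset.Nat.sum_antidiagonal_eq_sum_range_succ_mk] at this
      rw [newtonSeq_succ, eq_div_iff hk, this, neg_inj]
      refine Finset.sum_congr rfl fun i hi ↦ ?_
      rw [coeff_mk, ih (k - i) (by omega)]

open PowerSeries in
lemma mk_newtonSeq_add (p q : ℕ → ℂ) :
    PowerSeries.mk (newtonSeq (p + q)) =
      PowerSeries.mk (newtonSeq p) * PowerSeries.mk (newtonSeq q) := by
  refine (eq_mk_newtonSeq ?_ ?_).symm
  · rw [map_mul, ← coeff_zero_eq_constantCoeff_apply, ← coeff_zero_eq_constantCoeff_apply,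
      coeff_mk, coeff_mk, newtonSeq_zero, newtonSeq_zero, one_mul]
  · rw [Derivation.leibniz, derivative_mk_newtonSeq, derivative_mk_newtonSeq,
      show PowerSeries.mk (p + q) = PowerSeries.mk p + PowerSeries.mk q from rfl,
      smul_eq_mul, smul_eq_mul]
    ring

lemma newtonSeq_add (p q : ℕ → ℂ) (k : ℕ) :
    newtonSeq (p + q) k =
      ∑ r ∈ Finset.range (k + 1), newtonSeq p r * newtonSeq q (k - r) := by
  have := congrArg (PowerSeries.coeff k) (mk_newtonSeq_add p q)
  rw [PowerSeries.coeff_mul, Finset.Nat.sum_antidiagonal_eq_sum_range_succ_mk] at this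
  simpa using this

open PowerSeries in
lemma newtonSeq_single (c : ℂ) (k : ℕ) :
    newtonSeq (Pi.single 0 c) k = (-c) ^ k / k.factorial := by
  suffices h : PowerSeries.mk (fun k : ℕ ↦ (-c) ^ k / (k.factorial : ℂ)) =
      PowerSeries.mk (newtonSeq (Pi.single 0 c)) by
    simpa using (congrArg (coeff k) h).symm
  have hc : PowerSeries.mk (Pi.single 0 c) = C c := by
    ext n
    rw [coeff_mk, coeff_C]
    by_cases h : n = 0 <;> simp [h]
  refine eq_mk_newtonSeq (by rw [← coeff_zero_eq_constantCoeff_apply]; simp) ?_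
  ext n
  rw [hc, map_neg, coeff_derivative, coeff_C_mul, coeff_mk, coeff_mk, Nat.factorial_succ]
  have : (n : ℂ) + 1 ≠ 0 := by exact_mod_cast Nat.succ_ne_zero n
  have h2 : (n.factorial : ℂ) ≠ 0 := by exact_mod_cast n.factorial_ne_zero
  push_cast
  field_simp
  ring

open PowerSeries in
lemma mk_newtonSeq_pow (y : ℂ) : PowerSeries.mk (newtonSeq fun i ↦ y ^ (i + 1)) = 1 - C y * X := by
  refine (eq_mk_newtonSeq (by simp) ?_).symm
  have h : (PowerSeries.mk fun i ↦ y ^ (i + 1)) * (1 - C y * X) = C y := by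
    have h1 : (PowerSeries.mk fun i ↦ y ^ (i + 1)) = C y * PowerSeries.mk (fun i ↦ y ^ i) := by
      ext n; simp [pow_succ']
    have h2 : PowerSeries.mk (fun i ↦ y ^ i) * (1 - C y * X) = 1 := by
      ext n
      rw [mul_sub, mul_one, map_sub, ← mul_assoc, mul_comm _ (C y), mul_assoc]
      cases n with
      | zero => simp
      | succ n => simp [coeff_succ_mul_X, coeff_one, pow_succ']
    rw [h1, mul_assoc, h2, mul_one]
  rw [h]
  ext n
  cases n with
  | zero => simp
  | succ n => simp

open PowerSeries in
lemma mk_newtonSeq_sum {ι : Type*} (y : ι → ℂ) (F : Finset ι) :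
    PowerSeries.mk (newtonSeq fun i ↦ ∑ a ∈ F, y a ^ (i + 1)) = ∏ a ∈ F, (1 - C (y a) * X) := by
  classical
  induction F using Finset.induction_on with
  | empty =>
    rw [Finset.prod_empty]
    exact (eq_mk_newtonSeq (by simp) (by ext; simp)).symm
  | insert a F ha ih =>
    rw [Finset.prod_insert ha, ← ih, ← mk_newtonSeq_pow, ← mk_newtonSeq_add]
    congr 2
    ext i
    simp [Finset.sum_insert ha]

open PowerSeries in
lemma newtonSeq_sum {ι : Type*} (y : ι → ℂ) (F : Finset ι) (k : ℕ) :
    newtonSeq (fun i ↦ ∑ a ∈ F, y a ^ (i + 1)) k =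
      (-1) ^ k * ∑ T ∈ F.powerset, if T.card = k then ∏ a ∈ T, y a else 0 := by
  have h := congrArg (coeff k) (mk_newtonSeq_sum y F)
  rw [coeff_mk] at h
  rw [h]
  simp_rw [sub_eq_add_neg]
  rw [Finset.prod_one_add, map_sum, Finset.mul_sum]
  refine Finset.sum_congr rfl fun T _ ↦ ?_
  have : ∏ a ∈ T, -(C (y a) * X) = C ((-1) ^ T.card * ∏ a ∈ T, y a) * X ^ T.card := by
    rw [Finset.prod_neg, Finset.prod_mul_distrib, Finset.prod_const, ← map_prod]
    simp [mul_assoc]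
  rw [this, coeff_C_mul, coeff_X_pow]
  by_cases hT : T.card = k
  · simp [hT]
  · simp [hT, Ne.symm hT]

/-- Each term of the sequence is a polynomial in finitely many power sums, so pointwise limits are
enough and no uniformity in i is needed. -/
lemma tendsto_newtonSeq {α : Type*} {l : Filter α} {p : α → ℕ → ℂ} {q : ℕ → ℂ}
    (h : ∀ i, Tendsto (fun a ↦ p a i) l (𝓝 (q i))) (k : ℕ) :
    Tendsto (fun a ↦ newtonSeq (p a) k) l (𝓝 (newtonSeq q k)) := by
  induction k using Nat.strong_induction_on with
  | _ k ih =>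
    cases k with
    | zero => simpa only [newtonSeq_zero] using tendsto_const_nhds
    | succ k =>
      simp_rw [newtonSeq_succ]
      exact (tendsto_finsetSum _ fun i _ ↦ (h i).mul (ih _ (by omega))).neg.div_const _

/-- A subalgebra of functions that contains the power sums contains the elementary symmetric
functions. -/
lemma newtonSeq_mem {α : Type*} (A : Subalgebra ℂ (α → ℂ)) {p : α → ℕ → ℂ}
    (h : ∀ i, (fun a ↦ p a i) ∈ A) (k : ℕ) : (fun a ↦ newtonSeq (p a) k) ∈ A := by
  induction k using Nat.strong_induction_on with
  | _ k ih =>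
    cases k with
    | zero => simpa only [newtonSeq_zero] using! A.one_mem
    | succ k =>
      have : (fun a ↦ newtonSeq (p a) (k + 1)) =
          (-(1 / ((k : ℂ) + 1))) • ∑ i ∈ Finset.range (k + 1),
            ((fun a ↦ p a i) * fun a ↦ newtonSeq (p a) (k - i)) := by
        ext a
        simp only [newtonSeq_succ, Pi.smul_apply, Finset.sum_apply, Pi.mul_apply, smul_eq_mul]
        ring
      rw [this]
      exact A.smul_mem (A.sum_mem fun i _ ↦ A.mul_mem (h i) (ih _ (by omega))) _

/-! ### Elementary symmetric sums of infinite families -/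

lemma summable_pow_succ {ι : Type*} {y : ι → ℂ} (hs : Summable fun a ↦ ‖y a‖) (i : ℕ) :
    Summable fun a ↦ y a ^ (i + 1) := by
  have h1 : ∀ᶠ a in cofinite, ‖y a‖ < 1 :=
    hs.tendsto_cofinite_zero.eventually (gt_mem_nhds one_pos)
  refine Summable.of_norm_bounded_eventually hs ?_
  filter_upwards [h1] with a ha
  rw [norm_pow, pow_succ]
  exact mul_le_of_le_one_left (norm_nonneg _) (pow_le_one₀ (norm_nonneg _) ha.le)

lemma hasSum_finset_card_eq {ι : Type*} {y : ι → ℂ} (hs : Summable fun a ↦ ‖y a‖) (k : ℕ) :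
    HasSum (fun T : Finset ι ↦ if T.card = k then ∏ a ∈ T, y a else 0)
      ((-1) ^ k * newtonSeq (fun i ↦ ∑' a, y a ^ (i + 1)) k) := by
  have hg : Summable (fun T : Finset ι ↦ if T.card = k then ∏ a ∈ T, y a else 0) := by
    refine (summable_finsetProd_of_summable_norm hs).norm.of_norm_bounded fun T ↦ ?_
    split_ifs
    · rfl
    · simpa using Finset.prod_nonneg fun a _ ↦ norm_nonneg (y a)
  -- The powersets of growing finite sets F exhaust all finite subsets, so the full sum is the limit
  -- of the partial sums to which Newton's identities for F apply.
  have h1 := hg.hasSum.comp tendsto_finset_powerset_atTop_atTop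
  have h2 : Tendsto (fun F : Finset ι ↦ newtonSeq (fun i ↦ ∑ a ∈ F, y a ^ (i + 1)) k) atTop
      (𝓝 (newtonSeq (fun i ↦ ∑' a, y a ^ (i + 1)) k)) :=
    tendsto_newtonSeq (fun i ↦ (summable_pow_succ hs i).hasSum) k
  have h3 := h2.const_mul ((-1 : ℂ) ^ k)
  simp_rw [newtonSeq_sum, ← mul_assoc, ← mul_pow, neg_one_mul, neg_neg, one_pow, one_mul] at h3
  rw [← tendsto_nhds_unique h1 h3]
  exact hg.hasSum

lemma hasSum_reciprocalTerm {ι : Type*} {f : ι → ℂ} (hf : Function.Injective f)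
    (hs : Summable fun a ↦ ‖(f a)⁻¹‖) (k : ℕ) :
    HasSum (reciprocalTerm (Set.range f) k)
      ((-1) ^ k * newtonSeq (fun i ↦ ∑' a, (f a)⁻¹ ^ (i + 1)) k) := by
  classical
  let g : {T : Finset ℂ // T.card = k ∧ (T : Set ℂ) ⊆ Set.range f} → Finset ι :=
    fun T ↦ T.1.preimage f hf.injOn
  have himage (T) : (g T).image f = T.1 := by
    rw [Finset.image_preimage]
    exact Finset.filter_true_of_mem fun x hx ↦ T.2.2 hx
  have hginj : Function.Injective g := fun T T' h ↦ Subtype.ext <| by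
    rw [← himage T, ← himage T', h]
  have hcard (T) : (g T).card = k := by
    rw [← Finset.card_image_of_injective _ hf, himage, T.2.1]
  have hrange : ∀ T ∉ Set.range g, (if T.card = k then ∏ a ∈ T, (f a)⁻¹ else 0) = 0 := by
    refine fun T hT ↦ if_neg fun h ↦ hT ⟨⟨T.image f, ?_, ?_⟩, ?_⟩
    · rw [Finset.card_image_of_injective _ hf, h]
    · simp
    · ext a
      simp [g, hf.eq_iff]
  have := (hginj.hasSum_iff hrange).mpr (hasSum_finset_card_eq hs k)
  refine this.congr_fun ?_
  intro T
  simp only [Function.comp_apply, hcard, if_true, reciprocalTerm]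
  rw [← himage T, Finset.prod_image fun _ _ _ _ h ↦ hf h]

/-! ### Lattice points modulo sign -/

/-- Coordinates of a system of representatives of the nonzero vectors of `ℤ²` modulo `± 1`. -/
def halfVec : ℕ ⊕ (ℕ × ℤ) → Fin 2 → ℤ :=
  Sum.elim (fun n ↦ ![0, n + 1]) (fun p ↦ ![p.1 + 1, p.2])

/-- A system of representatives of the nonzero points of `ℤ + ℤτ` modulo `± 1`. -/
def halfPoint (τ : ℍ) : ℕ ⊕ (ℕ × ℤ) → ℂ :=
  Sum.elim (fun n ↦ n + 1) (fun p ↦ (p.1 + 1) * τ + p.2)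

/-- The points `ω² |ω|^{2s}` for `ω` in a half system of lattice points. -/
def halfPower (τ : ℍ) (s : ℝ) (a : ℕ ⊕ (ℕ × ℤ)) : ℂ :=
  halfPoint τ a ^ 2 * ((‖halfPoint τ a‖ ^ (2 * s) : ℝ) : ℂ)

lemma halfPoint_eq (τ : ℍ) (a : ℕ ⊕ (ℕ × ℤ)) :
    halfPoint τ a = halfVec a 0 * τ + halfVec a 1 := by
  rcases a with n | ⟨m, n⟩ <;> simp [halfPoint, halfVec]

lemma halfVec_ne_zero (a : ℕ ⊕ (ℕ × ℤ)) : halfVec a ≠ 0 := by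
  intro h
  have h0 := congrFun h 0
  have h1 := congrFun h 1
  rcases a with n | ⟨m, n⟩ <;> simp [halfVec] at h0 h1 <;> omega

lemma eq_of_halfVec_eq_or_neg {a b : ℕ ⊕ (ℕ × ℤ)}
    (h : halfVec a = halfVec b ∨ halfVec a = -halfVec b) : a = b := by
  rcases h with h | h <;>
  · have h0 := congrFun h 0
    have h1 := congrFun h 1
    rcases a with n | ⟨m, n⟩ <;> rcases b with n' | ⟨m', n'⟩ <;>
      simp [halfVec] at h0 h1 ⊢ <;> omega

lemma halfVec_injective : Function.Injective halfVec := fun _ _ h ↦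
  eq_of_halfVec_eq_or_neg (.inl h)

lemma exists_halfVec {v : Fin 2 → ℤ} (hv : v ≠ 0) : ∃ a, v = halfVec a ∨ v = -halfVec a := by
  rcases lt_trichotomy (v 0) 0 with h | h | h
  · refine ⟨.inr ((-v 0 - 1).toNat, -v 1), .inr ?_⟩
    ext i
    fin_cases i <;> simp [halfVec]
    omega
  · rcases lt_trichotomy (v 1) 0 with h' | h' | h'
    · refine ⟨.inl (-v 1 - 1).toNat, .inr ?_⟩
      ext i
      fin_cases i <;> simp [halfVec, h]
      omega
    · exact absurd (by ext i; fin_cases i <;> simp [h, h']) hv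
    · refine ⟨.inl (v 1 - 1).toNat, .inl ?_⟩
      ext i
      fin_cases i <;> simp [halfVec, h]
      omega
  · refine ⟨.inr ((v 0 - 1).toNat, v 1), .inl ?_⟩
    ext i
    fin_cases i <;> simp [halfVec]
    omega

lemma intCast_mul_add_injective (τ : ℍ) :
    Function.Injective fun v : Fin 2 → ℤ ↦ (v 0 : ℂ) * τ + v 1 := by
  intro v w h
  have him := congrArg Complex.im h
  have hre := congrArg Complex.re h
  have hτ : τ.im ≠ 0 := τ.im_ne_zero
  simp at him hre
  have h0 : v 0 = w 0 := by simpa [hτ] using him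
  have h1 : v 1 = w 1 := by simpa [h0] using hre
  ext i
  fin_cases i <;> assumption

lemma eq_of_halfPoint_sq_eq {τ : ℍ} {a b : ℕ ⊕ (ℕ × ℤ)}
    (h : halfPoint τ a ^ 2 = halfPoint τ b ^ 2) : a = b := by
  rw [sq_eq_sq_iff_eq_or_eq_neg, halfPoint_eq, halfPoint_eq] at h
  refine eq_of_halfVec_eq_or_neg (h.imp (fun h ↦ intCast_mul_add_injective τ h) fun h ↦
    intCast_mul_add_injective τ ?_)
  simp only [h, Pi.neg_apply, Int.cast_neg]
  ring

lemma one_le_norm_halfVec (a : ℕ ⊕ (ℕ × ℤ)) : 1 ≤ ‖halfVec a‖ := by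
  have h : 0 < ‖halfVec a‖ := norm_pos_iff.mpr (halfVec_ne_zero a)
  rw [EisensteinSeries.norm_eq_max_natAbs] at h ⊢
  exact_mod_cast h

lemma mul_norm_halfVec_le (τ : ℍ) (a : ℕ ⊕ (ℕ × ℤ)) :
    EisensteinSeries.r τ * ‖halfVec a‖ ≤ ‖halfPoint τ a‖ := by
  rw [halfPoint_eq]
  exact EisensteinSeries.r_mul_max_le τ (halfVec_ne_zero a)

lemma le_norm_halfPoint (τ : ℍ) (a : ℕ ⊕ (ℕ × ℤ)) :
    EisensteinSeries.r τ ≤ ‖halfPoint τ a‖ :=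
  (le_mul_of_one_le_right (EisensteinSeries.r_pos τ).le (one_le_norm_halfVec a)).trans
    (mul_norm_halfVec_le τ a)

lemma norm_halfPoint_pos (τ : ℍ) (a : ℕ ⊕ (ℕ × ℤ)) : 0 < ‖halfPoint τ a‖ :=
  (EisensteinSeries.r_pos τ).trans_le (le_norm_halfPoint τ a)

lemma halfPoint_ne_zero (τ : ℍ) (a : ℕ ⊕ (ℕ × ℤ)) : halfPoint τ a ≠ 0 :=
  norm_pos_iff.mp (norm_halfPoint_pos τ a)

lemma summable_norm_halfPoint_rpow (τ : ℍ) {k : ℝ} (hk : 2 < k) :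
    Summable fun a ↦ ‖halfPoint τ a‖ ^ (-k) := by
  refine Summable.of_nonneg_of_le (fun a ↦ by positivity) (fun a ↦ ?_)
    (((EisensteinSeries.summable_one_div_norm_rpow hk).mul_left
      (EisensteinSeries.r τ ^ (-k))).comp_injective halfVec_injective)
  rw [halfPoint_eq]
  exact EisensteinSeries.summand_bound τ (by linarith) (halfVec a)

lemma summable_norm_halfPoint_pow (τ : ℍ) {k : ℕ} (hk : 2 < k) :
    Summable fun a ↦ (‖halfPoint τ a‖ ^ k)⁻¹ := by
  refine (summable_norm_halfPoint_rpow τ (k := k) (by exact_mod_cast hk)).congr fun a ↦ ?_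
  rw [Real.rpow_neg (norm_nonneg _), Real.rpow_natCast]

lemma norm_halfPower (τ : ℍ) (s : ℝ) (a : ℕ ⊕ (ℕ × ℤ)) :
    ‖halfPower τ s a‖ = ‖halfPoint τ a‖ ^ (2 + 2 * s) := by
  rw [halfPower, norm_mul, norm_pow, Complex.norm_real, Real.norm_of_nonneg (by positivity),
    Real.rpow_add (norm_halfPoint_pos τ a), Real.rpow_two]

/-- Norms recover |ω| because the exponent 2 + 2s is nonzero, then ω² can be cancelled out.
Injectivity lets subsets of the value set be indexed by subsets of the half system. -/
lemma halfPower_injective (τ : ℍ) {s : ℝ} (hs : 0 ≤ s) : Function.Injective (halfPower τ s) := by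
  intro a b h
  have h1 : ‖halfPoint τ a‖ = ‖halfPoint τ b‖ := by
    have := congrArg norm h
    rw [norm_halfPower, norm_halfPower] at this
    exact (Real.rpow_left_inj (norm_nonneg _) (norm_nonneg _) (by linarith)).mp this
  have h2 : ((‖halfPoint τ b‖ ^ (2 * s) : ℝ) : ℂ) ≠ 0 := by
    have := norm_halfPoint_pos τ b
    exact_mod_cast (by positivity : 0 < ‖halfPoint τ b‖ ^ (2 * s)).ne'
  rw [halfPower, halfPower, h1] at h
  exact eq_of_halfPoint_sq_eq (mul_right_cancel₀ h2 h)

lemma range_halfPower (τ : ℍ) (s : ℝ) : Set.range (halfPower τ s) = latticePowers τ s := by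
  ext x
  constructor
  · rintro ⟨a, rfl⟩
    refine ⟨halfPoint τ a, ⟨halfVec a 1, halfVec a 0, ?_⟩, halfPoint_ne_zero τ a, rfl⟩
    rw [halfPoint_eq, add_comm]
  · rintro ⟨w, ⟨m, n, rfl⟩, hw, rfl⟩
    have hv : ![n, m] ≠ 0 := by
      intro h
      have h0 := congrFun h 0
      have h1 := congrFun h 1
      simp at h0 h1
      simp [h0, h1] at hw
    have key (v : Fin 2 → ℤ) (hv : v = ![n, m]) : (m : ℂ) + n * τ = v 0 * τ + v 1 := by
      simp [hv, add_comm]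
    obtain ⟨a, ha | ha⟩ := exists_halfVec hv
    · refine ⟨a, ?_⟩
      rw [key _ ha.symm, ← halfPoint_eq, halfPower]
    · refine ⟨a, ?_⟩
      have : (m : ℂ) + n * τ = -halfPoint τ a := by
        rw [key _ rfl, ha, halfPoint_eq]
        simp
        ring
      rw [this, norm_neg, neg_sq, halfPower]

lemma summable_norm_inv_halfPower (τ : ℍ) {s : ℝ} (hs : 0 < s) :
    Summable fun a ↦ ‖(halfPower τ s a)⁻¹‖ := by
  refine (summable_norm_halfPoint_rpow τ (k := 2 + 2 * s) (by linarith)).congr fun a ↦ ?_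
  rw [norm_inv, norm_halfPower, Real.rpow_neg (norm_nonneg _)]

/-- The power sums of the inverses of the points `ω² |ω|^{2s}`. -/
def powerSum (τ : ℍ) (s : ℝ) (i : ℕ) : ℂ := ∑' a, (halfPower τ s a)⁻¹ ^ (i + 1)

lemma hasSum_reciprocalTerm_latticePowers (τ : ℍ) {s : ℝ} (hs : 0 < s) (k : ℕ) :
    HasSum (reciprocalTerm (latticePowers τ s) k) ((-1) ^ k * newtonSeq (powerSum τ s) k) := by
  have := hasSum_reciprocalTerm (halfPower_injective τ hs.le)
    (summable_norm_inv_halfPower τ hs) k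
  rw [range_halfPower] at this
  exact this

lemma symmSum_latticePowers (τ : ℍ) {s : ℝ} (hs : 0 < s) (k : ℕ) :
    symmSum (latticePowers τ s) k = (-1) ^ k * newtonSeq (powerSum τ s) k :=
  (hasSum_reciprocalTerm_latticePowers τ hs k).tsum_eq

/-! ### Limits of the higher power sums -/

lemma tendsto_powerSum_succ (τ : ℍ) (i : ℕ) :
    Tendsto (fun s ↦ powerSum τ s (i + 1)) (𝓝[>] 0)
      (𝓝 (∑' a, (halfPoint τ a ^ (2 * (i + 2)))⁻¹)) := by
  set r := EisensteinSeries.r τ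
  have hr : 0 < r := EisensteinSeries.r_pos τ
  -- All lattice points satisfy |ω| ≥ r, so for 0 < s < 1 the factor |ω|^{-2s} is at most 1 when |ω|
  -- ≥ 1 and at most r⁻² otherwise.
  let C : ℝ := max 1 (r ^ (-2 : ℝ))
  have hC : 1 ≤ C := le_max_left _ _
  refine tendsto_tsum_of_dominated_convergence
    (bound := fun a ↦ C ^ (i + 2) * (‖halfPoint τ a‖ ^ (2 * (i + 2)))⁻¹) ?_ ?_ ?_
  · exact (summable_norm_halfPoint_pow τ (by omega)).mul_left _
  · intro a
    have ha := norm_halfPoint_pos τ a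
    have h1 : Tendsto (fun s : ℝ ↦ halfPower τ s a) (𝓝[>] 0) (𝓝 (halfPoint τ a ^ 2)) := by
      have h2 : Tendsto (fun s : ℝ ↦ ‖halfPoint τ a‖ ^ (2 * s)) (𝓝[>] 0) (𝓝 1) := by
        have : ContinuousAt (fun s : ℝ ↦ ‖halfPoint τ a‖ ^ (2 * s)) 0 :=
          ContinuousAt.rpow (by fun_prop) (by fun_prop) (.inl ha.ne')
        simpa using! (this.tendsto.mono_left nhdsWithin_le_nhds)
      have h3 := (Complex.continuous_ofReal.tendsto 1).comp h2
      simpa using! h3.const_mul (halfPoint τ a ^ 2)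
    convert! (h1.inv₀ (pow_ne_zero 2 (halfPoint_ne_zero τ a))).pow (i + 2) using 2
    rw [pow_mul, inv_pow]
  · have h1 : ∀ᶠ s : ℝ in 𝓝[>] 0, s < 1 :=
      (gt_mem_nhds one_pos : ∀ᶠ s : ℝ in 𝓝 0, s < 1).filter_mono nhdsWithin_le_nhds
    filter_upwards [self_mem_nhdsWithin, h1] with s hs0 hs1 a
    have hs0 : 0 < s := hs0
    have ha := norm_halfPoint_pos τ a
    have h2 : ‖halfPoint τ a‖ ^ (-(2 * s)) ≤ C := by
      rcases le_total 1 ‖halfPoint τ a‖ with h | h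
      · exact (Real.rpow_le_one_of_one_le_of_nonpos h (by linarith)).trans hC
      · refine le_trans ?_ (le_max_right _ _)
        refine (Real.rpow_le_rpow_of_exponent_ge ha h (by linarith : (-2 : ℝ) ≤ _)).trans ?_
        exact Real.rpow_le_rpow_of_nonpos hr (le_norm_halfPoint τ a) (by norm_num)
    have h3 : ‖(halfPower τ s a)⁻¹‖ ≤ C * (‖halfPoint τ a‖ ^ 2)⁻¹ := by
      rw [norm_inv, norm_halfPower, Real.rpow_add ha, mul_inv, ← Real.rpow_neg ha.le (2 * s),
        Real.rpow_two, mul_comm]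
      gcongr
    rw [norm_pow]
    refine (pow_le_pow_left₀ (norm_nonneg _) h3 _).trans (le_of_eq ?_)
    rw [mul_pow, pow_mul, inv_pow]

/-! ### Hecke's trick: local estimates -/

/-- Hecke's summand `w⁻² |w|^{-2s}`. -/
def heckeTerm (s : ℝ) (w : ℂ) : ℂ := (w ^ 2)⁻¹ * ((‖w‖ ^ (-(2 * s)) : ℝ) : ℂ)

lemma inv_halfPower (τ : ℍ) (s : ℝ) (a : ℕ ⊕ (ℕ × ℤ)) :
    (halfPower τ s a)⁻¹ = heckeTerm s (halfPoint τ a) := by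
  rw [halfPower, heckeTerm, mul_inv, Real.rpow_neg (norm_nonneg _), Complex.ofReal_inv]

lemma norm_heckeTerm (s : ℝ) {w : ℂ} (hw : w ≠ 0) : ‖heckeTerm s w‖ = ‖w‖ ^ (-2 - 2 * s) := by
  have : 0 < ‖w‖ := norm_pos_iff.mpr hw
  rw [heckeTerm, norm_mul, norm_inv, norm_pow, Complex.norm_real,
    Real.norm_of_nonneg (by positivity), sub_eq_add_neg, Real.rpow_add this,
    Real.rpow_neg this.le 2,
    Real.rpow_two]

lemma heckeTerm_zero (w : ℂ) : heckeTerm 0 w = (w ^ 2)⁻¹ := by simp [heckeTerm]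

lemma continuousAt_heckeTerm {s : ℝ} {w : ℂ} (hw : w ≠ 0) :
    ContinuousAt (fun p : ℝ × ℂ ↦ heckeTerm p.1 p.2) (s, w) := by
  unfold heckeTerm
  refine ContinuousAt.mul (ContinuousAt.inv₀ (by fun_prop) (pow_ne_zero 2 hw)) ?_
  refine Complex.continuous_ofReal.continuousAt.comp ?_
  exact ContinuousAt.rpow (by fun_prop) (by fun_prop) (.inl (norm_ne_zero_iff.mpr hw))

/-- With x = a/b ≤ 1 and 2s ≤ 2 one has 1 - x^{2s} ≤ 1 - x² ≤ 2(1 - x), a bound that does not depend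
on s. -/
lemma abs_rpow_sub_rpow_le {a b s : ℝ} (ha : 0 < a) (hab : a ≤ b) (hs0 : 0 ≤ s) (hs1 : s ≤ 1) :
    |a ^ (-(2 * s)) - b ^ (-(2 * s))| ≤ a ^ (-(2 * s)) * (2 * (b - a) / b) := by
  have hb : 0 < b := ha.trans_le hab
  have h0 : 0 ≤ a / b := by positivity
  have h1 : a / b ≤ 1 := (div_le_one hb).mpr hab
  have h2 : b ^ (-(2 * s)) = a ^ (-(2 * s)) * (a / b) ^ (2 * s) := by
    rw [Real.div_rpow ha.le hb.le, Real.rpow_neg ha.le, Real.rpow_neg hb.le]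
    have : a ^ (2 * s) ≠ 0 := by positivity
    field_simp
  have h3 : (a / b) ^ (2 : ℝ) ≤ (a / b) ^ (2 * s) :=
    Real.rpow_le_rpow_of_exponent_ge (by positivity) h1 (by linarith)
  have h4 : (a / b) ^ (2 * s) ≤ 1 := Real.rpow_le_one h0 h1 (by linarith)
  rw [h2, ← mul_one_sub, abs_mul, abs_of_pos (by positivity), abs_of_nonneg (by linarith)]
  gcongr
  rw [Real.rpow_two] at h3
  have : 2 * (b - a) / b = 2 * (1 - a / b) := by field_simp
  rw [this]
  nlinarith

/-- A shift by t ≤ 1 gains one power of |w|, uniformly in s, which is what makes the differences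
summable over the lattice. The maximum bounds |u|^{-2s} for Im u ≥ y. The factor 1 + y⁻¹ compares
|w| with |w + t|, which differ by at most 1. Finally 4 + y⁻¹ is 2 + y⁻¹ from varying w⁻² plus 2 from
varying |w|^{-2s}. -/
lemma norm_heckeTerm_sub_le {y s t : ℝ} {w : ℂ} (hy : 0 < y) (hw : y ≤ w.im) (hs0 : 0 ≤ s)
    (hs1 : s ≤ 1) (ht0 : 0 ≤ t) (ht1 : t ≤ 1) :
    ‖heckeTerm s w - heckeTerm s (w + t)‖ ≤
      max 1 (y ^ (-2 : ℝ)) * (1 + y⁻¹) ^ 2 * (4 + y⁻¹) * (‖w‖ ^ 3)⁻¹ := by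
  set C := max 1 (y ^ (-2 : ℝ))
  have hC : 0 < C := lt_of_lt_of_le one_pos (le_max_left _ _)
  have hbound {u : ℂ} (hu : y ≤ u.im) : y ≤ ‖u‖ ∧ ‖u‖ ^ (-(2 * s)) ≤ C := by
    have h1 : y ≤ ‖u‖ := hu.trans ((le_abs_self _).trans (Complex.abs_im_le_norm u))
    refine ⟨h1, ?_⟩
    rcases le_total 1 ‖u‖ with h | h
    · exact (Real.rpow_le_one_of_one_le_of_nonpos h (by linarith)).trans (le_max_left _ _)
    · refine le_trans ?_ (le_max_right _ _)
      exact (Real.rpow_le_rpow_of_exponent_ge (hy.trans_le h1) h (by linarith)).trans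
        (Real.rpow_le_rpow_of_nonpos hy h1 (by norm_num))
  obtain ⟨hy1, hC1⟩ := hbound hw
  obtain ⟨hy2, hC2⟩ := hbound (u := w + t) (by simpa using hw)
  set a := ‖w‖ with ha
  set b := ‖w + t‖ with hb
  have hab : b ≤ a + 1 := (norm_add_le _ _).trans (by
    rw [Complex.norm_real, Real.norm_of_nonneg ht0]; linarith)
  have hba : a ≤ b + 1 := by
    have := norm_sub_le (w + t) t
    rw [add_sub_cancel_right, Complex.norm_real, Real.norm_of_nonneg ht0] at this
    linarith
  have ha0 : 0 < a := hy.trans_le hy1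
  have hb0 : 0 < b := hy.trans_le hy2
  have hw0 : w ≠ 0 := norm_pos_iff.mp ha0
  have hw1 : w + t ≠ 0 := norm_pos_iff.mp hb0
  have hK1 : a ≤ (1 + y⁻¹) * b := by
    have : 1 ≤ y⁻¹ * b := by rw [inv_mul_eq_div, one_le_div hy]; exact hy2
    linarith
  have hK2 : b ≤ (1 + y⁻¹) * a := by
    have : 1 ≤ y⁻¹ * a := by rw [inv_mul_eq_div, one_le_div hy]; exact hy1
    linarith
  have hKinv : b⁻¹ ≤ (1 + y⁻¹) * a⁻¹ := by
    rw [inv_le_iff_one_le_mul₀ hb0, mul_right_comm, ← div_eq_mul_inv, one_le_div ha0]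
    exact hK1
  have hpow : |a ^ (-(2 * s)) - b ^ (-(2 * s))| ≤ 2 * C * a⁻¹ := by
    rcases le_total a b with h | h
    · refine (abs_rpow_sub_rpow_le ha0 h hs0 hs1).trans ?_
      have : 2 * (b - a) / b ≤ 2 * a⁻¹ := by
        rw [div_eq_mul_inv]
        have : b⁻¹ ≤ a⁻¹ := inv_anti₀ ha0 h
        have h0 : 0 ≤ b⁻¹ := by positivity
        nlinarith
      calc _ ≤ C * (2 * a⁻¹) := by
            refine mul_le_mul hC1 this (div_nonneg (by linarith) hb0.le) hC.le
        _ = _ := by ring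
    · rw [abs_sub_comm]
      refine (abs_rpow_sub_rpow_le hb0 h hs0 hs1).trans ?_
      have : 2 * (a - b) / a ≤ 2 * a⁻¹ := by
        rw [div_eq_mul_inv]
        have h0 : 0 ≤ a⁻¹ := by positivity
        nlinarith
      calc _ ≤ C * (2 * a⁻¹) := by
            refine mul_le_mul hC2 this (div_nonneg (by linarith) ha0.le) hC.le
        _ = _ := by ring
  have hsq : ‖(w ^ 2)⁻¹ - ((w + t) ^ 2)⁻¹‖ ≤ (1 + y⁻¹) ^ 2 * (2 + y⁻¹) * (a ^ 3)⁻¹ := by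
    have h1 : (w ^ 2)⁻¹ - ((w + t) ^ 2)⁻¹ =
        t * (w + (w + t)) * (w⁻¹ ^ 2 * (w + t)⁻¹ ^ 2) := by
      field_simp
      ring
    have h2 : ‖w + (w + t)‖ ≤ (2 + y⁻¹) * a := (norm_add_le _ _).trans (by linarith)
    rw [h1, norm_mul, norm_mul, norm_mul, norm_pow, norm_pow, norm_inv, norm_inv,
      Complex.norm_real, Real.norm_of_nonneg ht0, ← ha, ← hb]
    calc t * ‖w + (w + t)‖ * (a⁻¹ ^ 2 * b⁻¹ ^ 2)
        ≤ 1 * ((2 + y⁻¹) * a) * (a⁻¹ ^ 2 * ((1 + y⁻¹) * a⁻¹) ^ 2) := by gcongr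
      _ = _ := by field_simp
  have hdecomp : heckeTerm s w - heckeTerm s (w + t) =
      ((w ^ 2)⁻¹ - ((w + t) ^ 2)⁻¹) * ((a ^ (-(2 * s)) : ℝ) : ℂ) +
        ((w + t) ^ 2)⁻¹ * ((a ^ (-(2 * s)) - b ^ (-(2 * s)) : ℝ) : ℂ) := by
    rw [heckeTerm, heckeTerm, ← ha, ← hb]
    push_cast
    ring
  rw [hdecomp]
  refine (norm_add_le _ _).trans ?_
  rw [norm_mul, norm_mul, Complex.norm_real, Complex.norm_real, norm_inv, norm_pow, ← hb,
    Real.norm_of_nonneg (by positivity), Real.norm_eq_abs, ← inv_pow b]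
  calc _ ≤ ((1 + y⁻¹) ^ 2 * (2 + y⁻¹) * (a ^ 3)⁻¹) * C +
        ((1 + y⁻¹) * a⁻¹) ^ 2 * (2 * C * a⁻¹) := by gcongr
    _ = _ := by field_simp; ring

/-! ### The integral of Hecke's summand along a row -/

open MeasureTheory

lemma one_add_sq_pos (x : ℝ) : 0 < 1 + x ^ 2 := by positivity

lemma ofReal_add_I_ne_zero (x : ℝ) : (x : ℂ) + Complex.I ≠ 0 := fun h ↦ by
  simpa using congrArg Complex.im h

lemma norm_ofReal_add_I_rpow (x r : ℝ) :
    ‖(x : ℂ) + Complex.I‖ ^ (2 * r) = (1 + x ^ 2) ^ r := by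
  rw [Real.rpow_mul (norm_nonneg _), Real.rpow_two, ← Complex.normSq_eq_norm_sq]
  congr 1
  simp [Complex.normSq_apply]
  ring

lemma integrable_one_add_sq_rpow {s : ℝ} (hs : 0 ≤ s) :
    Integrable fun x : ℝ ↦ (1 + x ^ 2) ^ (-1 - s) := by
  refine integrable_inv_one_add_sq.mono' ?_ (.of_forall fun x ↦ ?_)
  · exact (Continuous.rpow_const (by fun_prop) fun x ↦
      .inl (one_add_sq_pos x).ne').aestronglyMeasurable
  · have h := one_add_sq_pos x
    rw [Real.norm_of_nonneg (by positivity), ← Real.rpow_neg_one]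
    exact Real.rpow_le_rpow_of_exponent_le (by nlinarith) (by linarith)

lemma tendsto_integral_one_add_sq_rpow :
    Tendsto (fun s : ℝ ↦ ∫ x : ℝ, (1 + x ^ 2) ^ (-1 - s)) (𝓝[>] 0) (𝓝 Real.pi) := by
  rw [← integral_univ_inv_one_add_sq]
  refine tendsto_integral_filter_of_dominated_convergence (fun x ↦ (1 + x ^ 2)⁻¹) ?_ ?_
    integrable_inv_one_add_sq ?_
  · filter_upwards [self_mem_nhdsWithin] with s hs
    exact (integrable_one_add_sq_rpow (le_of_lt hs)).aestronglyMeasurable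
  · filter_upwards [self_mem_nhdsWithin] with s hs
    refine .of_forall fun x ↦ ?_
    have hs : 0 < s := hs
    have h := one_add_sq_pos x
    rw [Real.norm_of_nonneg (by positivity), ← Real.rpow_neg_one]
    exact Real.rpow_le_rpow_of_exponent_le (by nlinarith) (by linarith)
  · refine .of_forall fun x ↦ ?_
    have : ContinuousAt (fun s : ℝ ↦ (1 + x ^ 2) ^ (-1 - s)) 0 :=
      ContinuousAt.rpow (by fun_prop) (by fun_prop) (.inl (one_add_sq_pos x).ne')
    have h := this.tendsto.mono_left (nhdsWithin_le_nhds (s := Set.Ioi 0))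
    rwa [sub_zero, Real.rpow_neg_one] at h

lemma continuous_heckeTerm_add_I (s : ℝ) : Continuous fun x : ℝ ↦ heckeTerm s (x + Complex.I) :=
  continuous_iff_continuousAt.mpr fun x ↦
    (continuousAt_heckeTerm (s := s) (ofReal_add_I_ne_zero x)).comp
      (f := fun x : ℝ ↦ (s, (x : ℂ) + Complex.I)) (by fun_prop)

lemma norm_heckeTerm_add_I (s x : ℝ) :
    ‖heckeTerm s (x + Complex.I)‖ = (1 + x ^ 2) ^ (-1 - s) := by
  rw [norm_heckeTerm _ (ofReal_add_I_ne_zero x), ← norm_ofReal_add_I_rpow]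
  ring_nf

lemma integrable_heckeTerm_add_I {s : ℝ} (hs : 0 ≤ s) :
    Integrable fun x : ℝ ↦ heckeTerm s (x + Complex.I) :=
  (integrable_one_add_sq_rpow hs).mono' (continuous_heckeTerm_add_I s).aestronglyMeasurable
    (.of_forall fun x ↦ (norm_heckeTerm_add_I s x).le)

/-- The function vanishes at ±∞, so integrating its derivative yields (1 + s)∫`heckeTerm` + s∫(1 +
x²)^{-1-s} = 0. This exhibits the factor s that will cancel the pole of ζ. -/
lemma hasDerivAt_heckePrimitive (s x : ℝ) :
    HasDerivAt (fun x : ℝ ↦ ((x : ℂ) + Complex.I)⁻¹ * (((1 + x ^ 2) ^ (-s) : ℝ) : ℂ))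
      (-((1 + s) * heckeTerm s (x + Complex.I) + s * (((1 + x ^ 2) ^ (-1 - s) : ℝ) : ℂ))) x := by
  have hx := one_add_sq_pos x
  have h1 : HasDerivAt (fun x : ℝ ↦ ((x : ℂ) + Complex.I)⁻¹)
      (-1 / ((x : ℂ) + Complex.I) ^ 2) x :=
    ((Complex.ofRealCLM.hasDerivAt (x := x)).add_const Complex.I).inv (ofReal_add_I_ne_zero x)
  have h2 : HasDerivAt (fun x : ℝ ↦ (1 + x ^ 2) ^ (-s))
      (2 * x * (-s) * (1 + x ^ 2) ^ (-s - 1)) x := by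
    have := ((hasDerivAt_pow 2 x).const_add 1).rpow_const (p := -s) (.inl hx.ne')
    convert! this using 1
    simp
  convert! h1.mul h2.ofReal_comp using 1
  have h3 : ((1 + x ^ 2) ^ (-s) : ℝ) = (1 + x ^ 2) * (1 + x ^ 2) ^ (-1 - s) := by
    rw [show -s = -1 - s + 1 by ring, Real.rpow_add_one hx.ne', mul_comm]
  have h4 : (-s - 1 : ℝ) = -1 - s := by ring
  have h5 : ((1 : ℂ) + (x : ℂ) ^ 2) = (x + Complex.I) * (x - Complex.I) := by
    ring_nf
    simp
    ring
  have hne := ofReal_add_I_ne_zero x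
  rw [heckeTerm, show -(2 * s) = 2 * (-s) by ring, norm_ofReal_add_I_rpow, h3, h4]
  push_cast
  rw [h5]
  field_simp
  ring

lemma integral_heckeTerm_add_I {s : ℝ} (hs : 0 ≤ s) :
    ∫ x : ℝ, heckeTerm s (x + Complex.I) =
      ((-(s / (1 + s)) * ∫ x : ℝ, (1 + x ^ 2) ^ (-1 - s) : ℝ) : ℂ) := by
  have hint : Integrable fun x : ℝ ↦ (((1 + x ^ 2) ^ (-1 - s) : ℝ) : ℂ) :=
    (integrable_one_add_sq_rpow hs).ofReal
  have hnorm {x : ℝ} (h0 : x ≠ 0) :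
      ‖((x : ℂ) + Complex.I)⁻¹ * (((1 + x ^ 2) ^ (-s) : ℝ) : ℂ)‖ ≤ |x|⁻¹ := by
    have hx := one_add_sq_pos x
    rw [norm_mul, norm_inv, Complex.norm_real, Real.norm_of_nonneg (by positivity)]
    have h1 : |x| ≤ ‖(x : ℂ) + Complex.I‖ := by
      simpa using Complex.abs_re_le_norm ((x : ℂ) + Complex.I)
    have h2 : (1 + x ^ 2) ^ (-s) ≤ 1 :=
      Real.rpow_le_one_of_one_le_of_nonpos (by nlinarith) (by linarith)
    calc _ ≤ |x|⁻¹ * 1 := by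
          gcongr
      _ = _ := mul_one _
  have h0 := integral_of_hasDerivAt_of_tendsto (hasDerivAt_heckePrimitive s)
    (((integrable_heckeTerm_add_I hs).const_mul _).add (hint.const_mul _)).neg
    (squeeze_zero_norm' ((eventually_ne_atBot 0).mono fun _ h ↦ hnorm h)
      (tendsto_inv_atTop_zero.comp tendsto_abs_atBot_atTop))
    (squeeze_zero_norm' ((eventually_ne_atTop 0).mono fun _ h ↦ hnorm h)
      (tendsto_inv_atTop_zero.comp tendsto_abs_atTop_atTop))
  rw [integral_neg, integral_add ((integrable_heckeTerm_add_I hs).const_mul _)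
    (hint.const_mul _), integral_const_mul, integral_const_mul, integral_complex_ofReal] at h0
  have h1 : (1 + s : ℂ) ≠ 0 := by exact_mod_cast (by linarith : (1 + s : ℝ) ≠ 0)
  push_cast
  field_simp
  linear_combination -h0

lemma heckeTerm_real_mul {s c : ℝ} (hc : 0 < c) (w : ℂ) :
    heckeTerm s (c * w) = ((c ^ (-2 - 2 * s) : ℝ) : ℂ) * heckeTerm s w := by
  rw [heckeTerm, heckeTerm, norm_mul, Complex.norm_real, Real.norm_of_nonneg hc.le,
    Real.mul_rpow hc.le (norm_nonneg _), sub_eq_add_neg, Real.rpow_add hc, Real.rpow_neg hc.le 2,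
    Real.rpow_two]
  push_cast
  field_simp

lemma heckeTerm_add_eq {s : ℝ} {w : ℂ} (hw : 0 < w.im) (x : ℝ) :
    heckeTerm s (w + x) = ((w.im ^ (-2 - 2 * s) : ℝ) : ℂ) *
      heckeTerm s ((w.im⁻¹ * (x + w.re) : ℝ) + Complex.I) := by
  rw [← heckeTerm_real_mul hw]
  congr 1
  have : (w.im : ℂ) ≠ 0 := by exact_mod_cast hw.ne'
  push_cast
  field_simp
  nth_rw 1 [← Complex.re_add_im w]
  ring

lemma integrable_heckeTerm_add {s : ℝ} (hs : 0 ≤ s) {w : ℂ} (hw : 0 < w.im) :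
    Integrable fun x : ℝ ↦ heckeTerm s (w + x) := by
  simp_rw [heckeTerm_add_eq hw]
  exact (((integrable_heckeTerm_add_I hs).comp_mul_left' (inv_ne_zero hw.ne')).comp_add_right
    w.re).const_mul _

lemma integral_heckeTerm_add {s : ℝ} (hs : 0 ≤ s) {w : ℂ} (hw : 0 < w.im) :
    ∫ x : ℝ, heckeTerm s (w + x) = ((-(s / (1 + s)) * w.im ^ (-1 - 2 * s) *
      ∫ x : ℝ, (1 + x ^ 2) ^ (-1 - s) : ℝ) : ℂ) := by
  simp_rw [heckeTerm_add_eq hw]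
  rw [integral_const_mul, integral_add_right_eq_self (μ := volume)
    (fun x : ℝ ↦ heckeTerm s ((w.im⁻¹ * x : ℝ) + Complex.I)) w.re,
    Measure.integral_comp_mul_left (fun x : ℝ ↦ heckeTerm s (x + Complex.I)),
    integral_heckeTerm_add_I hs, inv_inv, abs_of_pos hw, Complex.real_smul]
  have : w.im ^ (-1 - 2 * s) = w.im ^ (-2 - 2 * s) * w.im := by
    rw [← Real.rpow_add_one hw.ne']
    ring_nf
  rw [this]
  push_cast
  ring

/-! ### Comparison of row sums with row integrals -/

/-- The difference between Hecke's summand and its average over the unit interval to its right. -/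
def heckeDiff (s : ℝ) (w : ℂ) : ℂ := ∫ t in (0 : ℝ)..1, (heckeTerm s w - heckeTerm s (w + t))

lemma add_ofReal_ne_zero {w : ℂ} (hw : 0 < w.im) (t : ℝ) : w + t ≠ 0 := fun h ↦ by
  have := congrArg Complex.im h
  simp at this
  exact hw.ne' this

lemma continuous_heckeTerm_add (s : ℝ) {w : ℂ} (hw : 0 < w.im) :
    Continuous fun t : ℝ ↦ heckeTerm s (w + t) :=
  continuous_iff_continuousAt.mpr fun x ↦
    (continuousAt_heckeTerm (s := s) (add_ofReal_ne_zero hw x)).comp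
      (f := fun x : ℝ ↦ (s, w + x)) (by fun_prop)

lemma norm_heckeDiff_le {y s : ℝ} {w : ℂ} (hy : 0 < y) (hw : y ≤ w.im) (hs0 : 0 ≤ s)
    (hs1 : s ≤ 1) :
    ‖heckeDiff s w‖ ≤ max 1 (y ^ (-2 : ℝ)) * (1 + y⁻¹) ^ 2 * (4 + y⁻¹) * (‖w‖ ^ 3)⁻¹ := by
  have := intervalIntegral.norm_integral_le_of_norm_le_const (a := 0) (b := 1)
    (f := fun t : ℝ ↦ heckeTerm s w - heckeTerm s (w + t)) fun t ht ↦ by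
      rw [Set.uIoc_of_le zero_le_one] at ht
      exact norm_heckeTerm_sub_le hy hw hs0 hs1 ht.1.le ht.2
  simpa using! this

lemma tendsto_heckeDiff {w : ℂ} (hw : 0 < w.im) :
    Tendsto (fun s ↦ heckeDiff s w) (𝓝[>] 0) (𝓝 (heckeDiff 0 w)) := by
  have h1 : ∀ᶠ s : ℝ in 𝓝[>] 0, s < 1 :=
    (gt_mem_nhds one_pos : ∀ᶠ s : ℝ in 𝓝 0, s < 1).filter_mono nhdsWithin_le_nhds
  refine intervalIntegral.tendsto_integral_filter_of_dominated_convergence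
    (fun _ ↦ max 1 (w.im ^ (-2 : ℝ)) * (1 + w.im⁻¹) ^ 2 * (4 + w.im⁻¹) * (‖w‖ ^ 3)⁻¹) ?_ ?_ ?_ ?_
  · exact .of_forall fun s ↦
      (continuous_const.sub (continuous_heckeTerm_add s hw)).aestronglyMeasurable
  · filter_upwards [self_mem_nhdsWithin, h1] with s hs0 hs1
    refine .of_forall fun t ht ↦ ?_
    rw [Set.uIoc_of_le zero_le_one] at ht
    exact norm_heckeTerm_sub_le hw le_rfl (le_of_lt hs0) hs1.le ht.1.le ht.2
  · exact intervalIntegrable_const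
  · refine .of_forall fun t _ ↦ ?_
    have h2 {u : ℂ} (hu : u ≠ 0) : Tendsto (fun s ↦ heckeTerm s u) (𝓝[>] 0) (𝓝 (heckeTerm 0 u)) :=
      ((continuousAt_heckeTerm (s := 0) hu).comp (f := fun s : ℝ ↦ (s, u))
        (by fun_prop)).tendsto.mono_left nhdsWithin_le_nhds
    exact (h2 (by simpa using add_ofReal_ne_zero hw 0)).sub (h2 (add_ofReal_ne_zero hw t))

/-- The real line is cut into the intervals [n, n + 1], each of which supplies the average
subtracted in `heckeDiff`. -/
lemma hasSum_heckeTerm_add_int {s : ℝ} (hs : 0 ≤ s) {w : ℂ} (hw : 0 < w.im)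
    (hD : Summable fun n : ℤ ↦ heckeDiff s (w + n)) :
    HasSum (fun n : ℤ ↦ heckeTerm s (w + n))
      (∑' n : ℤ, heckeDiff s (w + n) + ∫ x : ℝ, heckeTerm s (w + x)) := by
  refine (hD.hasSum.add
    (integrable_heckeTerm_add hs hw).hasSum_intervalIntegral_comp_add_int).congr_fun fun n ↦ ?_
  have hn : 0 < (w + n).im := by simpa using hw
  rw [heckeDiff, intervalIntegral.integral_sub intervalIntegrable_const
    ((continuous_heckeTerm_add s hn).intervalIntegrable _ _)]
  have (x : ℝ) : w + n + x = w + ((x + n : ℝ) : ℂ) := by push_cast; ring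
  simp [this]

lemma halfPoint_inr (τ : ℍ) (p : ℕ × ℤ) :
    halfPoint τ (.inr p) = (p.1 + 1) * (τ : ℂ) + p.2 := rfl

lemma im_natCast_add_one_mul (τ : ℍ) (m : ℕ) : (((m : ℂ) + 1) * τ).im = (m + 1) * τ.im := by
  simp

lemma im_le_im_halfPoint (τ : ℍ) (p : ℕ × ℤ) : τ.im ≤ (halfPoint τ (.inr p)).im := by
  have := τ.im_pos
  rw [halfPoint_inr, Complex.add_im, im_natCast_add_one_mul, Complex.intCast_im]
  nlinarith [(Nat.cast_nonneg p.1 : (0 : ℝ) ≤ p.1)]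

lemma exists_norm_heckeDiff_halfPoint_le (τ : ℍ) : ∃ C : ℝ, ∀ s : ℝ, 0 ≤ s → s ≤ 1 → ∀ p : ℕ × ℤ,
    ‖heckeDiff s (halfPoint τ (.inr p))‖ ≤ C * (‖halfPoint τ (.inr p)‖ ^ 3)⁻¹ :=
  ⟨_, fun _ hs0 hs1 p ↦ norm_heckeDiff_le τ.im_pos (im_le_im_halfPoint τ p) hs0 hs1⟩

lemma summable_norm_halfPoint_inr_pow (τ : ℍ) {k : ℕ} (hk : 2 < k) :
    Summable fun p ↦ (‖halfPoint τ (.inr p)‖ ^ k)⁻¹ :=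
  (summable_norm_halfPoint_pow τ hk).comp_injective Sum.inr_injective

lemma summable_heckeDiff (τ : ℍ) {s : ℝ} (hs0 : 0 ≤ s) (hs1 : s ≤ 1) :
    Summable fun p : ℕ × ℤ ↦ heckeDiff s (halfPoint τ (.inr p)) := by
  obtain ⟨C, hC⟩ := exists_norm_heckeDiff_halfPoint_le τ
  exact ((summable_norm_halfPoint_inr_pow τ (by norm_num)).mul_left C).of_norm_bounded
    (hC s hs0 hs1)

/-- The integral of Hecke's summand along a row of the lattice. -/
def rowIntegral (τ : ℍ) (s : ℝ) (m : ℕ) : ℝ :=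
  -(s / (1 + s)) * ((m + 1) * τ.im) ^ (-1 - 2 * s) * ∫ x : ℝ, (1 + x ^ 2) ^ (-1 - s)

lemma hasSum_heckeTerm_row (τ : ℍ) {s : ℝ} (hs0 : 0 ≤ s) (hs1 : s ≤ 1) (m : ℕ) :
    HasSum (fun n : ℤ ↦ heckeTerm s (halfPoint τ (.inr (m, n))))
      (∑' n : ℤ, heckeDiff s (halfPoint τ (.inr (m, n))) + rowIntegral τ s m) := by
  have him : 0 < (((m : ℂ) + 1) * τ).im := by
    rw [im_natCast_add_one_mul]
    have := τ.im_pos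
    positivity
  have := hasSum_heckeTerm_add_int hs0 him ((summable_heckeDiff τ hs0 hs1).prod_factor m)
  rwa [integral_heckeTerm_add hs0 him, im_natCast_add_one_mul] at this

lemma rowIntegral_zero (τ : ℍ) (m : ℕ) : rowIntegral τ 0 m = 0 := by simp [rowIntegral]

lemma hasSum_sq_inv_row (τ : ℍ) (m : ℕ) :
    HasSum (fun n : ℤ ↦ (halfPoint τ (.inr (m, n)) ^ 2)⁻¹)
      (∑' n : ℤ, heckeDiff 0 (halfPoint τ (.inr (m, n)))) := by
  simpa [rowIntegral_zero, heckeTerm_zero] using hasSum_heckeTerm_row τ le_rfl zero_le_one m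

/-- At s = 0 the row integrals vanish, so Eisenstein's iterated sum equals an absolutely convergent
double sum of differences. -/
lemma hasSum_tsum_sq_inv_row (τ : ℍ) :
    HasSum (fun m : ℕ ↦ ∑' n : ℤ, (halfPoint τ (.inr (m, n)) ^ 2)⁻¹)
      (∑' p : ℕ × ℤ, heckeDiff 0 (halfPoint τ (.inr p))) := by
  have h := summable_heckeDiff τ le_rfl zero_le_one
  simp_rw [fun m ↦ (hasSum_sq_inv_row τ m).tsum_eq]
  exact h.hasSum.prod_fiberwise fun m ↦ (h.prod_factor m).hasSum

lemma powerSum_zero_eq (τ : ℍ) {s : ℝ} (hs0 : 0 < s) (hs1 : s ≤ 1) :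
    powerSum τ s 0 = ∑' n : ℕ, heckeTerm s (halfPoint τ (.inl n)) +
      (∑' p : ℕ × ℤ, heckeDiff s (halfPoint τ (.inr p)) + ∑' m, (rowIntegral τ s m : ℂ)) := by
  have hsum : Summable fun a ↦ heckeTerm s (halfPoint τ a) := by
    refine Summable.of_norm ?_
    simpa only [inv_halfPower] using summable_norm_inv_halfPower τ hs0
  have hD := summable_heckeDiff τ hs0.le hs1
  have hl : Summable fun n ↦ heckeTerm s (halfPoint τ (.inl n)) :=
    hsum.comp_injective Sum.inl_injective
  have hr : Summable fun p ↦ heckeTerm s (halfPoint τ (.inr p)) :=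
    hsum.comp_injective Sum.inr_injective
  -- For s > 0 the double sums of terms and of differences both converge absolutely. Subtracting
  -- their row sums shows that the row integrals are summable and gives their sum.
  have h1 := hr.hasSum.prod_fiberwise fun m ↦ hasSum_heckeTerm_row τ hs0.le hs1 m
  have h2 := hD.hasSum.prod_fiberwise fun m ↦ (hD.prod_factor m).hasSum
  have h3 := h1.sub h2
  simp only [add_sub_cancel_left] at h3
  have h4 : powerSum τ s 0 = ∑' a, heckeTerm s (halfPoint τ a) :=
    tsum_congr fun a ↦ by rw [zero_add, pow_one, inv_halfPower]
  rw [h3.tsum_eq, add_sub_cancel, h4]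
  exact HasSum.tsum_eq (HasSum.sum (f := fun a ↦ heckeTerm s (halfPoint τ a)) hl.hasSum hr.hasSum)

lemma tendsto_tsum_rowIntegral (τ : ℍ) :
    Tendsto (fun s ↦ ∑' m, rowIntegral τ s m) (𝓝[>] 0) (𝓝 (-(Real.pi / (2 * τ.im)))) := by
  have hv := τ.im_pos
  have h1 : Tendsto (fun s : ℝ ↦ 1 + 2 * s) (𝓝[>] 0) (𝓝[>] 1) := by
    refine tendsto_nhdsWithin_iff.mpr ⟨?_, ?_⟩
    · have : ContinuousAt (fun s : ℝ ↦ 1 + 2 * s) 0 := by fun_prop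
      simpa using! this.tendsto.mono_left (nhdsWithin_le_nhds (s := Set.Ioi 0))
    · filter_upwards [self_mem_nhdsWithin] with s hs
      have : 0 < s := hs
      exact Set.mem_Ioi.mpr (by linarith)
  -- The residue of ζ at 1, in the variable 1 + 2s: 2s ∑ n^{-1-2s} → 1. The row integrals carry s
  -- and not 2s, whence the ½ in the limit.
  have h2 := tendsto_sub_mul_tsum_nat_rpow.comp h1
  have h3 : Tendsto (fun s : ℝ ↦ -(1 / (2 * (1 + s))) * τ.im ^ (-1 - 2 * s)) (𝓝[>] 0)
      (𝓝 (-(1 / 2) * τ.im⁻¹)) := by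
    have : ContinuousAt (fun s : ℝ ↦ -(1 / (2 * (1 + s))) * τ.im ^ (-1 - 2 * s)) 0 := by
      refine ContinuousAt.mul ?_ (ContinuousAt.rpow (by fun_prop) (by fun_prop) (.inl hv.ne'))
      exact (ContinuousAt.div (by fun_prop) (by fun_prop) (by norm_num)).neg
    have h := this.tendsto.mono_left (nhdsWithin_le_nhds (s := Set.Ioi 0))
    simpa [Real.rpow_neg_one] using! h
  have h4 := (h3.mul tendsto_integral_one_add_sq_rpow).mul h2
  have h5 : -(Real.pi / (2 * τ.im)) = -(1 / 2) * τ.im⁻¹ * Real.pi * 1 := by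
    field_simp
  rw [h5]
  refine h4.congr' ?_
  filter_upwards [self_mem_nhdsWithin] with s hs
  have hs : 0 < s := hs
  have hsum : Summable fun n : ℕ ↦ 1 / (n : ℝ) ^ (1 + 2 * s) :=
    Real.summable_one_div_nat_rpow.mpr (by linarith)
  have h6 : ∑' n : ℕ, 1 / (n : ℝ) ^ (1 + 2 * s) =
      ∑' m : ℕ, 1 / ((m : ℝ) + 1) ^ (1 + 2 * s) := by
    rw [hsum.tsum_eq_zero_add]
    simp [Real.zero_rpow (by linarith : 1 + 2 * s ≠ 0)]
  have h7 (m : ℕ) : rowIntegral τ s m = (-(s / (1 + s)) * τ.im ^ (-1 - 2 * s) *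
      ∫ x : ℝ, (1 + x ^ 2) ^ (-1 - s)) * (1 / ((m : ℝ) + 1) ^ (1 + 2 * s)) := by
    rw [rowIntegral, Real.mul_rpow (by positivity) hv.le, one_div,
      ← Real.rpow_neg (by positivity) (1 + 2 * s)]
    ring_nf
  simp_rw [h7]
  rw [tsum_mul_left, Function.comp_apply, h6]
  field_simp
  ring

/-- `½ G₂`, the first power sum at `s = 0` in Eisenstein's order of summation. -/
def halfG2 (τ : ℍ) : ℂ := ∑' n : ℕ, (halfPoint τ (.inl n) ^ 2)⁻¹ +
  ∑' m : ℕ, ∑' n : ℤ, (halfPoint τ (.inr (m, n)) ^ 2)⁻¹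

lemma tendsto_powerSum_zero (τ : ℍ) :
    Tendsto (fun s ↦ powerSum τ s 0) (𝓝[>] 0) (𝓝 (halfG2 τ - Real.pi / (2 * τ.im))) := by
  have hlt : ∀ᶠ s : ℝ in 𝓝[>] 0, s < 1 :=
    (gt_mem_nhds one_pos : ∀ᶠ s : ℝ in 𝓝 0, s < 1).filter_mono nhdsWithin_le_nhds
  have h1 : Tendsto (fun s ↦ ∑' n : ℕ, heckeTerm s (halfPoint τ (.inl n))) (𝓝[>] 0)
      (𝓝 (∑' n : ℕ, (halfPoint τ (.inl n) ^ 2)⁻¹)) := by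
    refine tendsto_tsum_of_dominated_convergence
      (bound := fun n : ℕ ↦ 1 / ((n + 1 : ℕ) : ℝ) ^ 2) ?_ ?_ ?_
    · exact (summable_nat_add_iff 1).mpr (Real.summable_one_div_nat_pow.mpr one_lt_two)
    · intro n
      rw [← heckeTerm_zero]
      exact ((continuousAt_heckeTerm (s := 0) (halfPoint_ne_zero τ _)).comp
        (f := fun s : ℝ ↦ (s, halfPoint τ (.inl n))) (by fun_prop)).tendsto.mono_left
          nhdsWithin_le_nhds
    · filter_upwards [self_mem_nhdsWithin] with s hs n
      have hs : 0 < s := hs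
      have hn : ‖halfPoint τ (.inl n)‖ = ((n + 1 : ℕ) : ℝ) := by
        rw [← Complex.norm_natCast]
        simp [halfPoint]
      rw [norm_heckeTerm _ (halfPoint_ne_zero τ _), hn, one_div, ← Real.rpow_two,
        ← Real.rpow_neg (by positivity)]
      exact Real.rpow_le_rpow_of_exponent_le (by simp) (by linarith)
  have h2 : Tendsto (fun s ↦ ∑' p : ℕ × ℤ, heckeDiff s (halfPoint τ (.inr p))) (𝓝[>] 0)
      (𝓝 (∑' p : ℕ × ℤ, heckeDiff 0 (halfPoint τ (.inr p)))) := by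
    obtain ⟨C, hC⟩ := exists_norm_heckeDiff_halfPoint_le τ
    refine tendsto_tsum_of_dominated_convergence
      ((summable_norm_halfPoint_inr_pow τ (k := 3) (by norm_num)).mul_left C) (fun p ↦ ?_) ?_
    · exact tendsto_heckeDiff (τ.im_pos.trans_le (im_le_im_halfPoint τ p))
    · filter_upwards [self_mem_nhdsWithin, hlt] with s hs0 hs1
      exact hC s (le_of_lt hs0) hs1.le
  have h3 := (Complex.continuous_ofReal.tendsto _).comp (tendsto_tsum_rowIntegral τ)
  have h4 := h1.add (h2.add h3)
  have h5 : halfG2 τ - Real.pi / (2 * τ.im) = ∑' n : ℕ, (halfPoint τ (.inl n) ^ 2)⁻¹ +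
      (∑' p : ℕ × ℤ, heckeDiff 0 (halfPoint τ (.inr p)) +
        ((-(Real.pi / (2 * τ.im)) : ℝ) : ℂ)) := by
    rw [halfG2, (hasSum_tsum_sq_inv_row τ).tsum_eq]
    push_cast
    ring
  rw [h5]
  refine h4.congr' ?_
  filter_upwards [self_mem_nhdsWithin, hlt] with s hs0 hs1
  rw [powerSum_zero_eq τ hs0 hs1.le, Function.comp_apply, Complex.ofReal_tsum]

/-! ### Identification with holomorphic Eisenstein series -/

open EisensteinSeries

lemma tsum_eisSummand_row_even {k : ℕ} (hk : Even k) (τ : ℍ) :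
    Function.Even fun m : ℤ ↦ ∑' n : ℤ, eisSummand k ![m, n] τ := by
  intro m
  simp only
  rw [← (Equiv.neg ℤ).tsum_eq]
  refine tsum_congr fun n ↦ ?_
  have : ((-m : ℤ) : ℂ) * τ + ((-n : ℤ) : ℂ) = -(m * τ + n) := by push_cast; ring
  simp only [eisSummand, Matrix.cons_val_zero, Matrix.cons_val_one, Equiv.neg_apply, this,
    zpow_neg, zpow_natCast, hk.neg_pow]

lemma tsum_tsum_eisSummand_eq {k : ℕ} (hk2 : 2 ≤ k) (hk : Even k) (τ : ℍ)
    (hs : Summable fun m : ℤ ↦ ∑' n : ℤ, eisSummand k ![m, n] τ) :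
    ∑' m : ℤ, ∑' n : ℤ, eisSummand k ![m, n] τ =
      2 * (∑' n : ℕ, (halfPoint τ (.inl n) ^ k)⁻¹ +
        ∑' m : ℕ, ∑' n : ℤ, (halfPoint τ (.inr (m, n)) ^ k)⁻¹) := by
  have hs0 : Summable fun n : ℤ ↦ eisSummand k ![0, n] τ := by
    refine (linear_right_summable τ 0 (k := k) (by exact_mod_cast hk2)).congr fun n ↦ ?_
    simp [eisSummand]
  have heven : Function.Even fun n : ℤ ↦ eisSummand k ![0, n] τ := by
    intro n
    simp [eisSummand, hk.neg_pow]
  rw [tsum_int_eq_zero_add_two_mul_tsum_pnat (tsum_eisSummand_row_even hk τ) hs,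
    tsum_int_eq_zero_add_two_mul_tsum_pnat heven hs0,
    tsum_pnat_eq_tsum_succ (f := fun n : ℕ ↦ eisSummand k ![0, (n : ℤ)] τ),
    tsum_pnat_eq_tsum_succ (f := fun m : ℕ ↦ ∑' n : ℤ, eisSummand k ![(m : ℤ), n] τ)]
  have h0 : eisSummand k ![0, 0] τ = 0 := by
    simp [eisSummand, zero_pow (by omega : k ≠ 0)]
  rw [h0, zero_add, nsmul_eq_mul, nsmul_eq_mul, Nat.cast_two, ← mul_add]
  simp [eisSummand, halfPoint]

/-- The outer sum defining `G2` is taken along a summation filter. The row sums are unconditionally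
summable by `hasSum_tsum_sq_inv_row`, so the filter can be dropped and the rows ±m paired. -/
lemma G2_eq_two_mul_halfG2 (τ : ℍ) : G2 τ = 2 * halfG2 τ := by
  have hnat : Summable fun m : ℕ ↦ e2Summand (m + 1) τ := by
    refine (hasSum_tsum_sq_inv_row τ).summable.congr fun m ↦ tsum_congr fun n ↦ ?_
    simp [eisSummand, halfPoint, zpow_neg, zpow_ofNat]
  have hs : Summable fun m : ℤ ↦ e2Summand m τ := by
    refine Summable.of_nat_of_neg_add_one ?_ ?_
    · exact (summable_nat_add_iff 1).mp (by simpa using hnat)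
    · refine hnat.congr fun m ↦ ?_
      exact (e2Summand_even τ (m + 1)).symm
  rw [G2, tsum_eq_of_summable_unconditional hs]
  exact tsum_tsum_eisSummand_eq le_rfl even_two τ hs

/-- The power sums at `s = 0`, the first one in Eisenstein's order of summation. -/
def holoPowerSum (τ : ℍ) : ℕ → ℂ
  | 0 => halfG2 τ
  | i + 1 => ∑' a, (halfPoint τ a ^ (2 * (i + 2)))⁻¹

/-- The limits of the power sums as `s → 0⁺`. -/
def limitPowerSum (τ : ℍ) : ℕ → ℂ :=
  holoPowerSum τ + Pi.single 0 (-(Real.pi / (2 * τ.im)))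

lemma tendsto_powerSum (τ : ℍ) (i : ℕ) :
    Tendsto (fun s ↦ powerSum τ s i) (𝓝[>] 0)
      (𝓝 (limitPowerSum τ i)) := by
  cases i with
  | zero => simpa [limitPowerSum, holoPowerSum, ← sub_eq_add_neg] using tendsto_powerSum_zero τ
  | succ i => simpa [limitPowerSum, holoPowerSum] using tendsto_powerSum_succ τ i

lemma summable_halfPoint_pow_inv (τ : ℍ) {k : ℕ} (hk : 2 < k) :
    Summable fun a ↦ (halfPoint τ a ^ k)⁻¹ := by
  refine Summable.of_norm ((summable_norm_halfPoint_pow τ hk).congr fun a ↦ ?_)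
  rw [norm_inv, norm_pow]

/-- Serves to transfer holomorphy and boundedness at i∞ from Eisenstein series. The division by 2
reflects the passage to one point of each pair ±ω. -/
lemma holoPowerSum_succ (τ : ℍ) (i : ℕ) :
    holoPowerSum τ (i + 1) = riemannZeta (2 * (i + 2) : ℕ) / 2 *
      eisensteinSeriesSIF (N := 1) 0 (2 * (i + 2) : ℕ) τ := by
  have hk : 3 ≤ 2 * (i + 2) := by omega
  have hsum := summable_prod_eisSummand hk τ
  have h1 := tsum_tsum_eisSummand_eq (by omega) (even_two_mul (i + 2)) τ hsum.prod
  have h2 : ∑' v, eisSummand (2 * (i + 2) : ℕ) v τ =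
      ∑' m : ℤ, ∑' n : ℤ, eisSummand (2 * (i + 2) : ℕ) ![m, n] τ := by
    rw [← (finTwoArrowEquiv ℤ).symm.tsum_eq]
    exact hsum.tsum_prod
  have hs := summable_halfPoint_pow_inv τ (by omega : 2 < 2 * (i + 2))
  have h3 : holoPowerSum τ (i + 1) = ∑' n : ℕ, (halfPoint τ (.inl n) ^ (2 * (i + 2)))⁻¹ +
      ∑' m : ℕ, ∑' n : ℤ, (halfPoint τ (.inr (m, n)) ^ (2 * (i + 2)))⁻¹ := by
    have hr : Summable fun p ↦ (halfPoint τ (.inr p) ^ (2 * (i + 2)))⁻¹ :=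
      hs.comp_injective Sum.inr_injective
    rw [← hr.tsum_prod]
    exact HasSum.tsum_eq (HasSum.sum (f := fun a ↦ (halfPoint τ a ^ (2 * (i + 2)))⁻¹)
      (hs.comp_injective Sum.inl_injective).hasSum hr.hasSum)
  have h4 := tsum_eisSummand_eq_riemannZeta_mul_eisensteinSeries hk τ
  rw [h2, h1, ← h3] at h4
  rw [eisensteinSeriesSIF_apply]
  linear_combination h4 / 2

/-- Holomorphic functions on the upper half-plane that are bounded at `i∞`. -/
def holoBounded : Subalgebra ℂ (ℍ → ℂ) where
  carrier := {f | MDifferentiable 𝓘(ℂ) 𝓘(ℂ) f ∧ UpperHalfPlane.IsBoundedAtImInfty f}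
  mul_mem' hf hg := ⟨hf.1.mul hg.1, hf.2.mul hg.2⟩
  add_mem' hf hg := ⟨hf.1.add hg.1, hf.2.add hg.2⟩
  algebraMap_mem' c := ⟨mdifferentiable_const, Filter.const_boundedAtFilter _ c⟩

lemma holoPowerSum_mem (i : ℕ) : (fun τ ↦ holoPowerSum τ i) ∈ holoBounded := by
  cases i with
  | zero =>
    have : (fun τ ↦ holoPowerSum τ 0) = riemannZeta 2 • E2 := by
      ext τ
      have h0 : riemannZeta 2 ≠ 0 := riemannZeta_ne_zero_of_one_lt_re (by simp)
      simp only [holoPowerSum, E2, Pi.smul_apply, smul_eq_mul, G2_eq_two_mul_halfG2]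
      field_simp
    rw [this]
    exact holoBounded.smul_mem ⟨E2_mdifferentiable, isBoundedAtImInfty_E2⟩ _
  | succ i =>
    have hk : (3 : ℤ) ≤ (2 * (i + 2) : ℕ) := by exact_mod_cast (by omega : 3 ≤ 2 * (i + 2))
    have : (fun τ ↦ holoPowerSum τ (i + 1)) = (riemannZeta (2 * (i + 2) : ℕ) / 2) •
        ⇑(eisensteinSeriesSIF (N := 1) 0 (2 * (i + 2) : ℕ)) := by
      ext τ
      exact holoPowerSum_succ τ i
    rw [this]
    refine holoBounded.smul_mem ⟨eisensteinSeriesSIF_mdifferentiable hk 0, ?_⟩ _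
    simpa using isBoundedAtImInfty_eisensteinSeriesSIF (N := 1) 0 hk 1

lemma newtonSeq_holoPowerSum_mem (k : ℕ) :
    (fun τ ↦ newtonSeq (holoPowerSum τ) k) ∈ holoBounded :=
  newtonSeq_mem _ holoPowerSum_mem k

/-! ### The limits as polynomials in 1/v -/

lemma tendsto_symmSum (k : ℕ) (τ : ℍ) :
    Tendsto (fun s : ℝ ↦ symmSum (latticePowers τ s) k) (𝓝[>] 0) (𝓝 ((-1) ^ k *
      newtonSeq (limitPowerSum τ) k)) := by
  refine ((tendsto_newtonSeq (tendsto_powerSum τ) k).const_mul ((-1) ^ k)).congr' ?_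
  filter_upwards [self_mem_nhdsWithin] with s hs
  exact (symmSum_latticePowers τ hs k).symm

lemma e_eq_newtonSeq (k : ℕ) (τ : ℍ) : e k τ = (-1) ^ k *
    newtonSeq (limitPowerSum τ) k :=
  (tendsto_symmSum k τ).limUnder_eq

/-- The coefficients of `e_k` as a polynomial in `1 / v`. -/
def depthCoeff (k r : ℕ) (τ : ℍ) : ℂ :=
  if r ≤ k then (-1) ^ k * ((Real.pi / 2) ^ r / r.factorial) * newtonSeq (holoPowerSum τ) (k - r)
  else 0

/-- The limiting power sums split into a holomorphic sequence and one supported at index 0. The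
second has generating series exp(πX/(2v)), and the Cauchy product gives the powers of 1/v. -/
lemma e_eq_sum (k : ℕ) (τ : ℍ) :
    e k τ = ∑ r ∈ Finset.range (k + 1), depthCoeff k r τ * (1 / (τ.im : ℂ)) ^ r := by
  rw [e_eq_newtonSeq, limitPowerSum, add_comm, newtonSeq_add, Finset.mul_sum]
  refine Finset.sum_congr rfl fun r hr ↦ ?_
  have : (τ.im : ℂ) ≠ 0 := by exact_mod_cast τ.im_ne_zero
  rw [depthCoeff, if_pos (by simpa [Nat.lt_succ_iff] using hr), newtonSeq_single]
  push_cast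
  rw [neg_neg, div_pow, mul_pow, div_pow, div_pow, one_pow]
  field_simp

lemma depthCoeff_mem (k r : ℕ) : depthCoeff k r ∈ holoBounded := by
  by_cases h : r ≤ k
  · have : depthCoeff k r = ((-1) ^ k * ((Real.pi / 2) ^ r / r.factorial) : ℂ) •
        fun τ ↦ newtonSeq (holoPowerSum τ) (k - r) := by
      ext τ
      simp [depthCoeff, h]
    rw [this]
    exact holoBounded.smul_mem (newtonSeq_holoPowerSum_mem _) _
  · have : depthCoeff k r = 0 := by
      ext τ
      simp [depthCoeff, h]
    rw [this]
    exact holoBounded.zero_mem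

lemma depthCoeff_self_ne_zero (k : ℕ) : depthCoeff k k ≠ 0 := by
  intro h
  have := congrFun h UpperHalfPlane.I
  simp [depthCoeff, newtonSeq_zero, Real.pi_ne_zero, Nat.factorial_ne_zero] at this

/-! ### The q-binomial theorem and the Jacobi triple product -/

/-- Gaussian binomial coefficients. -/
def qBinom (q : ℂ) : ℕ → ℕ → ℂ
  | _, 0 => 1
  | 0, _ + 1 => 0
  | n + 1, k + 1 => qBinom q n k + q ^ (k + 1) * qBinom q n (k + 1)

/-- The finite products `(1 - q) ⋯ (1 - qⁿ)`. -/
def qPoch (q : ℂ) (n : ℕ) : ℂ := ∏ j ∈ Finset.range n, (1 - q ^ (j + 1))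

lemma qBinom_zero_right (q : ℂ) (n : ℕ) : qBinom q n 0 = 1 := by cases n <;> rw [qBinom]

lemma qBinom_succ_succ (q : ℂ) (n k : ℕ) :
    qBinom q (n + 1) (k + 1) = qBinom q n k + q ^ (k + 1) * qBinom q n (k + 1) := by
  rw [qBinom]

lemma qBinom_eq_zero (q : ℂ) {n k : ℕ} (h : n < k) : qBinom q n k = 0 := by
  induction n generalizing k with
  | zero => obtain ⟨k, rfl⟩ := Nat.exists_eq_succ_of_ne_zero h.ne'; rw [qBinom]
  | succ n ih =>
    obtain ⟨k, rfl⟩ := Nat.exists_eq_succ_of_ne_zero (by omega : k ≠ 0)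
    rw [qBinom_succ_succ, ih (by omega), ih (by omega)]
    simp

/-- The factorial formula for Gaussian binomials, kept free of division so that it holds for every
q, by induction on a + b through the Pascal rule. -/
lemma qBinom_mul_qPoch (q : ℂ) (a b : ℕ) :
    qBinom q (a + b) a * (qPoch q a * qPoch q b) = qPoch q (a + b) := by
  induction h : a + b generalizing a b with
  | zero =>
    obtain ⟨rfl, rfl⟩ : a = 0 ∧ b = 0 := by omega
    simp [qBinom, qPoch]
  | succ n ih =>
    cases a with
    | zero =>
      obtain rfl : b = n + 1 := by omega
      rw [qBinom_zero_right]
      simp [qPoch]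
    | succ a =>
      rw [qBinom_succ_succ]
      have h1 := ih a b (by omega)
      have hP (m : ℕ) : qPoch q (m + 1) = qPoch q m * (1 - q ^ (m + 1)) := by
        rw [qPoch, qPoch, Finset.prod_range_succ]
      cases b with
      | zero =>
        obtain rfl : a = n := by omega
        rw [qBinom_eq_zero q (lt_add_one a), hP]
        linear_combination (1 - q ^ (a + 1)) * h1
      | succ b =>
        have h2 := ih (a + 1) b (by omega)
        obtain rfl : n = a + b + 1 := by omega
        rw [hP a] at h2 ⊢
        rw [hP b] at h1 ⊢
        rw [hP (a + b + 1)]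
        linear_combination (1 - q ^ (a + 1)) * h1 + q ^ (a + 1) * (1 - q ^ (b + 1)) * h2

/-- Cauchy's q-binomial theorem: after the factor with j = 0 is split off, the rest is the same
product at xq. -/
lemma prod_one_add_mul_pow (q x : ℂ) (n : ℕ) :
    ∏ j ∈ Finset.range n, (1 + x * q ^ j) =
      ∑ k ∈ Finset.range (n + 1), q ^ k.choose 2 * qBinom q n k * x ^ k := by
  induction n generalizing x with
  | zero => simp [qBinom]
  | succ n ih =>
    have h1 : ∀ j, 1 + x * q ^ (j + 1) = 1 + (x * q) * q ^ j := fun j ↦ by ring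
    rw [Finset.prod_range_succ', pow_zero, mul_one]
    simp_rw [h1]
    rw [ih, Finset.sum_range_succ' _ (n + 1)]
    have h2 (k : ℕ) : q ^ (k + 1).choose 2 * qBinom q (n + 1) (k + 1) * x ^ (k + 1) =
        q ^ k.choose 2 * qBinom q n k * (x * q) ^ k * x +
          q ^ (k + 1).choose 2 * qBinom q n (k + 1) * (x * q) ^ (k + 1) := by
      have : (k + 1).choose 2 = k.choose 2 + k := by
        rw [Nat.choose_succ_succ' k 1, Nat.choose_one_right, add_comm]
      rw [qBinom_succ_succ, this]
      ring
    simp_rw [h2]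
    rw [Finset.sum_add_distrib, ← Finset.sum_mul, mul_add, mul_one, add_comm]
    have h3 := Finset.sum_range_succ' (fun k ↦ q ^ k.choose 2 * qBinom q n k * (x * q) ^ k) (n + 1)
    rw [Finset.sum_range_succ, qBinom_eq_zero q (lt_add_one n)] at h3
    simp only [mul_zero, zero_mul, add_zero] at h3
    rw [h3]
    simp [qBinom_zero_right]
    ring

/-- The summands of the theta series, up to a factor that does not depend on `l`. -/
def tripleTerm (z τ : ℂ) (l : ℤ) : ℂ :=
  Complex.exp (Real.pi * Complex.I * τ * (l * (l - 1)) +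
    2 * Real.pi * Complex.I * (z + 1 / 2) * l)

lemma tripleTerm_eq_jacobiTheta₂_term (z τ : ℂ) (l : ℤ) :
    tripleTerm z τ l = jacobiTheta₂_term l (z + 1 / 2 - τ / 2) τ := by
  rw [tripleTerm, jacobiTheta₂_term]
  congr 1
  ring

lemma summable_tripleTerm (z : ℂ) (τ : ℍ) : Summable (tripleTerm z τ) := by
  simp_rw [funext (tripleTerm_eq_jacobiTheta₂_term z τ)]
  exact (summable_jacobiTheta₂_term_iff _ _).mpr τ.im_pos

/-- The product `(1 - ζ qᵐ)(1 - ζ⁻¹ qᵐ)`, with `m` shifted by one. -/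
def tripleFactor (z τ : ℂ) (m : ℕ) : ℂ :=
  (1 - Complex.exp (2 * Real.pi * Complex.I * z) *
    Complex.exp (2 * Real.pi * Complex.I * τ) ^ (m + 1)) *
  (1 - Complex.exp (-(2 * Real.pi * Complex.I * z)) *
    Complex.exp (2 * Real.pi * Complex.I * τ) ^ (m + 1))

lemma prod_tripleFactor (z τ : ℂ) (N : ℕ) :
    (1 - Complex.exp (2 * Real.pi * Complex.I * z)) *
        ∏ m ∈ Finset.range N, tripleFactor z τ m =
      ∑ k ∈ Finset.range (2 * N + 2),
        qBinom (Complex.exp (2 * Real.pi * Complex.I * τ)) (2 * N + 1) k *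
          tripleTerm z τ (k - N) := by
  set q := Complex.exp (2 * Real.pi * Complex.I * τ) with hq
  set ζ := Complex.exp (2 * Real.pi * Complex.I * z) with hζ
  have hhalf : Complex.exp (2 * Real.pi * Complex.I * (1 / 2)) = -1 := by
    rw [← Complex.exp_pi_mul_I]; ring_nf
  have hnegζ : -ζ = Complex.exp (2 * Real.pi * Complex.I * (z + 1 / 2)) := by
    rw [mul_add, Complex.exp_add, hhalf, hζ]; ring
  have hq0 : q ≠ 0 := Complex.exp_ne_zero _
  have hζ0 : ζ ≠ 0 := Complex.exp_ne_zero _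
  -- The choice x = -ζq^{-N} centres the product: the factor j = N is 1 - ζ, those above it are 1 -
  -- ζq^m, and those below become 1 - ζ⁻¹q^m once the monomials -ζq^{-m} are pulled out.
  have h1 := prod_one_add_mul_pow q (-ζ * (q ^ N)⁻¹) (2 * N + 1)
  have h2 : ∏ j ∈ Finset.range (2 * N + 1), (1 + -ζ * (q ^ N)⁻¹ * q ^ j) =
      (∏ j ∈ Finset.range N, (-ζ * (q ^ (j + 1))⁻¹)) *
        ((1 - ζ) * ∏ m ∈ Finset.range N, tripleFactor z τ m) := by
    have h3 : ∏ j ∈ Finset.range N, (1 + -ζ * (q ^ N)⁻¹ * q ^ j) =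
        ∏ j ∈ Finset.range N, ((-ζ * (q ^ (j + 1))⁻¹) * (1 - ζ⁻¹ * q ^ (j + 1))) := by
      rw [← Finset.prod_range_reflect]
      refine Finset.prod_congr rfl fun j hj ↦ ?_
      have hj : j < N := Finset.mem_range.mp hj
      obtain ⟨d, rfl⟩ : ∃ d, N = d + j + 1 := ⟨N - j - 1, by omega⟩
      rw [show d + j + 1 - 1 - j = d by omega]
      field_simp
      ring
    have h4 (j : ℕ) : 1 + -ζ * (q ^ N)⁻¹ * q ^ (N + (j + 1)) = 1 - ζ * q ^ (j + 1) := by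
      rw [pow_add]
      field_simp
      ring
    have h0 : 1 + -ζ * (q ^ N)⁻¹ * q ^ (N + 0) = 1 - ζ := by
      rw [add_zero]
      field_simp
      ring
    rw [show 2 * N + 1 = N + (N + 1) by ring, Finset.prod_range_add, h3, Finset.prod_range_succ',
      h0]
    simp_rw [h4, tripleFactor, Complex.exp_neg, ← hq, ← hζ]
    simp only [Finset.prod_mul_distrib]
    ring
  have h5 : ∏ j ∈ Finset.range N, (-ζ * (q ^ (j + 1))⁻¹) = Complex.exp
      (2 * Real.pi * Complex.I * (z + 1 / 2) * N - Real.pi * Complex.I * τ * (N * (N + 1))) := by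
    clear h1 h2
    induction N with
    | zero => simp
    | succ N ih =>
      rw [Finset.prod_range_succ, ih, hnegζ, hq, ← Complex.exp_nat_mul, ← Complex.exp_neg,
        ← Complex.exp_add, ← Complex.exp_add]
      congr 1
      push_cast
      ring
  rw [h2, h5] at h1
  refine mul_left_cancel₀ (Complex.exp_ne_zero _) (h1.trans ?_)
  rw [Finset.mul_sum]
  refine Finset.sum_congr rfl fun k _ ↦ ?_
  have h6 : q ^ k.choose 2 = Complex.exp (Real.pi * Complex.I * τ * (k * (k - 1))) := by
    rw [hq, ← Complex.exp_nat_mul, Nat.cast_choose_two]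
    ring_nf
  have h7 : (q ^ N)⁻¹ = Complex.exp (-(2 * Real.pi * Complex.I * τ * N)) := by
    rw [hq, ← Complex.exp_nat_mul, ← Complex.exp_neg]
    ring_nf
  rw [mul_pow, hnegζ, h6, h7, ← Complex.exp_nat_mul, ← Complex.exp_nat_mul, tripleTerm]
  have h8 (a b c d f B : ℂ) (h : a + b + c = d + f) : Complex.exp a * B *
      (Complex.exp b * Complex.exp c) = Complex.exp d * (B * Complex.exp f) := by
    have := congrArg Complex.exp h
    rw [Complex.exp_add, Complex.exp_add, Complex.exp_add] at this
    linear_combination B * this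
  refine h8 _ _ _ _ _ _ ?_
  push_cast
  ring

/-- The product `(1 - q)(1 - q²) ⋯`. -/
def eulerProd (q : ℂ) : ℂ := ∏' n : ℕ, (1 - q ^ (n + 1))

lemma tendsto_qPoch {q : ℂ} (hq : ‖q‖ < 1) : Tendsto (qPoch q) atTop (𝓝 (eulerProd q)) :=
  (ModularForm.multipliable_one_sub_pow hq).tendsto_prod_tprod_nat

lemma one_sub_pow_ne_zero {q : ℂ} (hq : ‖q‖ < 1) (n : ℕ) : 1 - q ^ (n + 1) ≠ 0 := by
  intro h
  have h1 : ‖q ^ (n + 1)‖ = 1 := by rw [← sub_eq_zero.mp h, norm_one]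
  rw [norm_pow] at h1
  exact (pow_lt_one₀ (norm_nonneg _) hq n.succ_ne_zero).ne h1

lemma qPoch_ne_zero {q : ℂ} (hq : ‖q‖ < 1) (n : ℕ) : qPoch q n ≠ 0 :=
  Finset.prod_ne_zero_iff.mpr fun j _ ↦ one_sub_pow_ne_zero hq j

lemma eulerProd_ne_zero {q : ℂ} (hq : ‖q‖ < 1) : eulerProd q ≠ 0 := by
  have h1 : Summable fun n : ℕ ↦ ‖-q ^ (n + 1)‖ := by
    simpa using (summable_nat_add_iff 1).mpr (summable_geometric_of_lt_one (norm_nonneg q) hq)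
  have := tprod_one_add_ne_zero_of_summable (f := fun n : ℕ ↦ -q ^ (n + 1))
    (fun n ↦ by simpa [← sub_eq_add_neg] using one_sub_pow_ne_zero hq n) h1
  simpa [eulerProd, sub_eq_add_neg] using this

lemma qBinom_eq {q : ℂ} (hq : ‖q‖ < 1) {n k : ℕ} (h : k ≤ n) :
    qBinom q n k = qPoch q n * ((qPoch q k)⁻¹ * (qPoch q (n - k))⁻¹) := by
  obtain ⟨b, rfl⟩ := Nat.exists_eq_add_of_le h
  rw [← qBinom_mul_qPoch, Nat.add_sub_cancel_left]
  have h1 := qPoch_ne_zero hq k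
  have h2 := qPoch_ne_zero hq b
  field_simp

lemma exists_norm_qBinom_le {q : ℂ} (hq : ‖q‖ < 1) : ∃ C : ℝ, ∀ n k, ‖qBinom q n k‖ ≤ C := by
  have h1 := tendsto_qPoch hq
  have h2 := h1.inv₀ (eulerProd_ne_zero hq)
  obtain ⟨A, hA⟩ := (Metric.isBounded_range_of_tendsto _ h1).exists_norm_le
  obtain ⟨B, hB⟩ := (Metric.isBounded_range_of_tendsto _ h2).exists_norm_le
  have hA' (n) : ‖qPoch q n‖ ≤ A := hA _ ⟨n, rfl⟩
  have hB' (n) : ‖(qPoch q n)⁻¹‖ ≤ B := hB _ ⟨n, rfl⟩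
  have hA0 : 0 ≤ A := (norm_nonneg _).trans (hA' 0)
  have hB0 : 0 ≤ B := (norm_nonneg _).trans (hB' 0)
  refine ⟨A * (B * B), fun n k ↦ ?_⟩
  rcases le_or_gt k n with h | h
  · rw [qBinom_eq hq h, norm_mul, norm_mul]
    gcongr
    exacts [hA' n, hB' k, hB' _]
  · rw [qBinom_eq_zero q h, norm_zero]
    positivity

lemma tendsto_qBinom {q : ℂ} (hq : ‖q‖ < 1) (l : ℤ) :
    Tendsto (fun N : ℕ ↦ qBinom q (2 * N + 1) (l + N).toNat) atTop (𝓝 (eulerProd q)⁻¹) := by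
  have h0 := eulerProd_ne_zero hq
  have h1 := tendsto_qPoch hq
  have h2 := h1.inv₀ h0
  have ht {f : ℕ → ℕ} (hf : ∀ N, N ≤ f N + l.natAbs) : Tendsto f atTop atTop := by
    refine tendsto_atTop.mpr fun b ↦ ?_
    filter_upwards [eventually_ge_atTop (b + l.natAbs)] with N hN
    have := hf N
    omega
  have h3 := (h1.comp (ht (f := fun N ↦ 2 * N + 1) fun N ↦ by omega)).mul
    ((h2.comp (ht (f := fun N ↦ (l + N).toNat) fun N ↦ by omega)).mul
      (h2.comp (ht (f := fun N ↦ 2 * N + 1 - (l + N).toNat) fun N ↦ by omega)))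
  rw [mul_inv_cancel_left₀ h0] at h3
  refine h3.congr' ?_
  filter_upwards [eventually_ge_atTop l.natAbs] with N hN
  rw [qBinom_eq hq (by omega)]
  rfl

lemma norm_exp_two_pi_I_mul_lt_one (τ : ℍ) : ‖Complex.exp (2 * Real.pi * Complex.I * τ)‖ < 1 :=
  UpperHalfPlane.norm_exp_two_pi_I_lt_one τ

/-- Dominated convergence in the finite identity: each Gaussian binomial tends to 1/∏(1 - q^n), and
all are bounded by one constant because the finite products and their inverses converge. -/
lemma tendsto_prod_tripleFactor (z : ℂ) (τ : ℍ) :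
    Tendsto (fun N ↦ (1 - Complex.exp (2 * Real.pi * Complex.I * z)) *
        ∏ m ∈ Finset.range N, tripleFactor z τ m) atTop
      (𝓝 ((eulerProd (Complex.exp (2 * Real.pi * Complex.I * τ)))⁻¹ *
        ∑' l, tripleTerm z τ l)) := by
  set q := Complex.exp (2 * Real.pi * Complex.I * τ) with hqdef
  have hq : ‖q‖ < 1 := norm_exp_two_pi_I_mul_lt_one τ
  obtain ⟨C, hC⟩ := exists_norm_qBinom_le hq
  have hC0 : 0 ≤ C := (norm_nonneg _).trans (hC 0 0)
  -- The finite sum over k = l + N is extended to all l in ℤ. Below, the condition cuts it off;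
  -- above, the Gaussian binomial vanishes for l + N > 2N + 1.
  let F (N : ℕ) (l : ℤ) : ℂ :=
    if 0 ≤ l + N then qBinom q (2 * N + 1) (l + N).toNat * tripleTerm z τ l else 0
  have hF (N : ℕ) : ∑' l, F N l = (1 - Complex.exp (2 * Real.pi * Complex.I * z)) *
      ∏ m ∈ Finset.range N, tripleFactor z τ m := by
    have hinj : Function.Injective fun k : ℕ ↦ (k : ℤ) - N := fun a b h ↦ by simpa using h
    rw [prod_tripleFactor, ← hinj.tsum_eq]
    · rw [tsum_eq_sum (s := Finset.range (2 * N + 2))]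
      · exact Finset.sum_congr rfl fun k _ ↦ by simp [F, hqdef]
      · intro k hk
        have : 2 * N + 2 ≤ k := by simpa using hk
        simp [F, qBinom_eq_zero q (Nat.lt_of_succ_le this)]
    · intro l hl
      have h0 : 0 ≤ l + N := by
        by_contra h
        exact hl (if_neg h)
      exact ⟨(l + N).toNat, by simp [h0]⟩
  simp_rw [← hF, ← tsum_mul_left]
  refine tendsto_tsum_of_dominated_convergence ((summable_tripleTerm z τ).norm.mul_left C)
    (fun l ↦ ?_) (.of_forall fun N l ↦ ?_)
  · refine ((tendsto_qBinom hq l).mul_const (tripleTerm z τ l)).congr' ?_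
    filter_upwards [eventually_ge_atTop l.natAbs] with N hN
    exact (if_pos (by omega)).symm
  · simp only [F]
    split_ifs
    · rw [norm_mul]
      gcongr
      exact hC _ _
    · rw [norm_zero]
      positivity

lemma theta_eq_tsum_tripleTerm (z : ℂ) (τ : ℍ) :
    theta z τ = Complex.exp (Real.pi * Complex.I * τ / 4 - Real.pi * Complex.I * (z + 1 / 2)) *
      ∑' l, tripleTerm z τ l := by
  rw [theta, ← (Equiv.addRight (1 : ℤ)).tsum_eq (tripleTerm z τ), ← tsum_mul_left]
  refine tsum_congr fun n ↦ ?_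
  rw [tripleTerm, ← Complex.exp_add, ← Complex.exp_add, Equiv.coe_addRight]
  congr 1
  push_cast
  ring

/-- The Jacobi triple product identity. -/
lemma tendsto_theta (z : ℂ) (τ : ℍ) :
    Tendsto (fun N ↦ -2 * Complex.sin (Real.pi * z) * Complex.exp (Real.pi * Complex.I * τ / 4) *
        eulerProd (Complex.exp (2 * Real.pi * Complex.I * τ)) *
        ∏ m ∈ Finset.range N, tripleFactor z τ m) atTop (𝓝 (theta z τ)) := by
  have h0 := eulerProd_ne_zero (norm_exp_two_pi_I_mul_lt_one τ)
  have h1 := (tendsto_prod_tripleFactor z τ).const_mul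
    (Complex.exp (Real.pi * Complex.I * τ / 4 - Real.pi * Complex.I * (z + 1 / 2)) *
      eulerProd (Complex.exp (2 * Real.pi * Complex.I * τ)))
  rw [mul_assoc (Complex.exp _) (eulerProd _), mul_inv_cancel_left₀ h0,
    ← theta_eq_tsum_tripleTerm] at h1
  refine h1.congr fun N ↦ ?_
  have h2 : Complex.exp (-(Real.pi * Complex.I * (z + 1 / 2))) *
      (1 - Complex.exp (2 * Real.pi * Complex.I * z)) = -2 * Complex.sin (Real.pi * z) := by
    have h3 : Complex.exp (-(Real.pi * Complex.I * (1 / 2))) = -Complex.I := by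
      rw [show -(Real.pi * Complex.I * (1 / 2)) = -(Real.pi / 2 * Complex.I) by ring,
        Complex.exp_neg, Complex.exp_pi_div_two_mul_I, Complex.inv_I]
    have h4 : Complex.exp (2 * Real.pi * Complex.I * z) =
        Complex.exp (Real.pi * Complex.I * z) * Complex.exp (Real.pi * Complex.I * z) := by
      rw [← Complex.exp_add]; ring_nf
    have h5 : Complex.exp (-(Real.pi * Complex.I * z)) * Complex.exp (Real.pi * Complex.I * z) =
        1 := by rw [← Complex.exp_add, neg_add_cancel, Complex.exp_zero]
    rw [mul_add, neg_add, Complex.exp_add, h3, h4, Complex.sin,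
      show -(Real.pi * z) * Complex.I = -(Real.pi * Complex.I * z) by ring,
      show (Real.pi * z) * Complex.I = Real.pi * Complex.I * z by ring]
    linear_combination Complex.I * Complex.exp (Real.pi * Complex.I * z) * h5
  rw [sub_eq_add_neg, Complex.exp_add, ← h2]
  ring

/-! ### Products over one row via Euler's sine product -/

lemma prod_Icc_neg_self (f : ℤ → ℂ) (N : ℕ) :
    ∏ n ∈ Finset.Icc (-(N : ℤ)) N, f n =
      f 0 * ∏ j ∈ Finset.range N, (f (j + 1) * f (-(j + 1))) := by
  induction N with
  | zero => simp
  | succ N ih =>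
    have : Finset.Icc (-((N + 1 : ℕ) : ℤ)) (N + 1 : ℕ) =
        insert ((N : ℤ) + 1) (insert (-((N : ℤ) + 1)) (Finset.Icc (-(N : ℤ)) N)) := by
      ext n
      simp only [Finset.mem_Icc, Finset.mem_insert]
      push_cast
      omega
    rw [this, Finset.prod_insert (by simp; omega), Finset.prod_insert (by simp), ih,
      Finset.prod_range_succ]
    ring

/-- Each factor is (w + n - z)(w + n + z)/(w + n)². The product converges unconditionally, so its
value may be computed on symmetric intervals, where n and -n combine to Euler products at w - z, w +
z and w. -/
lemma hasProd_one_sub_sq_div_sq {w : ℂ} (hw : ∀ n : ℤ, w + n ≠ 0) (z : ℂ) :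
    HasProd (fun n : ℤ ↦ 1 - z ^ 2 / (w + n) ^ 2)
      (Complex.sin (Real.pi * (w - z)) * Complex.sin (Real.pi * (w + z)) /
        Complex.sin (Real.pi * w) ^ 2) := by
  have hsin : Complex.sin (Real.pi * w) ≠ 0 := by
    intro h
    obtain ⟨k, hk⟩ := Complex.sin_eq_zero_iff.mp h
    have hπ : (Real.pi : ℂ) ≠ 0 := by exact_mod_cast Real.pi_ne_zero
    have : w = k := mul_left_cancel₀ hπ (by rw [hk, mul_comm])
    exact hw (-k) (by simp [this])
  have hsum : Summable fun n : ℤ ↦ ‖-(z ^ 2 / (w + n) ^ 2)‖ := by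
    have := (EisensteinSeries.linear_right_summable w 1 (k := 2) le_rfl).mul_left (-z ^ 2)
    refine this.norm.congr fun n ↦ ?_
    rw [Int.cast_one, one_mul, zpow_ofNat, ← div_eq_mul_inv, neg_div]
  have hm : Multipliable fun n : ℤ ↦ 1 - z ^ 2 / (w + n) ^ 2 := by
    simpa only [sub_eq_add_neg] using multipliable_one_add_of_summable hsum
  have h1 := hm.hasProd.comp
    (Finset.tendsto_Icc_neg_atTop_atTop.comp tendsto_natCast_atTop_atTop)
  have hA := (Complex.tendsto_euler_sin_prod (w - z)).mul (Complex.tendsto_euler_sin_prod (w + z))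
  have h2 := hA.div ((Complex.tendsto_euler_sin_prod w).pow 2) (pow_ne_zero 2 hsin)
  rw [← tendsto_nhds_unique h1 (h2.congr fun N ↦ ?_)]
  · exact hm.hasProd
  · simp only [Function.comp_apply, Pi.div_apply]
    have hw0 : w ≠ 0 := by simpa using hw 0
    have hπ : (Real.pi : ℂ) ≠ 0 := by exact_mod_cast Real.pi_ne_zero
    rw [prod_Icc_neg_self]
    have h3 : ∏ j ∈ Finset.range N, ((1 - z ^ 2 / (w + ((j : ℤ) + 1 : ℤ)) ^ 2) *
        (1 - z ^ 2 / (w + (-((j : ℤ) + 1) : ℤ)) ^ 2)) =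
        (∏ j ∈ Finset.range N, (1 - (w - z) ^ 2 / ((j : ℂ) + 1) ^ 2)) *
          (∏ j ∈ Finset.range N, (1 - (w + z) ^ 2 / ((j : ℂ) + 1) ^ 2)) /
          (∏ j ∈ Finset.range N, (1 - w ^ 2 / ((j : ℂ) + 1) ^ 2)) ^ 2 := by
      rw [← Finset.prod_mul_distrib, ← Finset.prod_pow, ← Finset.prod_div_distrib]
      refine Finset.prod_congr rfl fun j _ ↦ ?_
      have hj : (j : ℂ) + 1 ≠ 0 := Nat.cast_add_one_ne_zero j
      have ha : w + ((j : ℂ) + 1) ≠ 0 := by simpa using hw (j + 1)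
      have hb : w - ((j : ℂ) + 1) ≠ 0 := by simpa [sub_eq_add_neg, add_comm] using hw (-(j + 1))
      have hc : ((j : ℂ) + 1) ^ 2 - w ^ 2 ≠ 0 := by
        rw [← neg_ne_zero, neg_sub, sq_sub_sq]
        exact mul_ne_zero ha hb
      push_cast
      rw [← sub_eq_add_neg]
      have hd : (1 : ℂ) - w ^ 2 / ((j : ℂ) + 1) ^ 2 =
          -((w + ((j : ℂ) + 1)) * (w - ((j : ℂ) + 1))) / ((j : ℂ) + 1) ^ 2 := by
        field_simp
        ring
      rw [hd]
      field_simp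
      ring
    rw [h3]
    have h4 : ∏ j ∈ Finset.range N, (1 - w ^ 2 / ((j : ℂ) + 1) ^ 2) ≠ 0 := by
      refine Finset.prod_ne_zero_iff.mpr fun j _ ↦ ?_
      have hj : (j : ℂ) + 1 ≠ 0 := Nat.cast_add_one_ne_zero j
      have ha : w + ((j : ℂ) + 1) ≠ 0 := by simpa using hw (j + 1)
      have hb : w - ((j : ℂ) + 1) ≠ 0 := by simpa [sub_eq_add_neg, add_comm] using hw (-(j + 1))
      have hd : (1 : ℂ) - w ^ 2 / ((j : ℂ) + 1) ^ 2 =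
          -((w + ((j : ℂ) + 1)) * (w - ((j : ℂ) + 1))) / ((j : ℂ) + 1) ^ 2 := by
        field_simp
        ring
      rw [hd]
      exact div_ne_zero (neg_ne_zero.mpr (mul_ne_zero ha hb)) (pow_ne_zero 2 hj)
    simp only [Int.cast_zero, add_zero]
    field_simp
    ring

lemma sin_pi_mul_eq (x : ℂ) : Complex.sin (Real.pi * x) = Complex.I / 2 *
    Complex.exp (-(Real.pi * Complex.I * x)) *
      (1 - Complex.exp (2 * Real.pi * Complex.I * x)) := by
  have h4 : Complex.exp (2 * Real.pi * Complex.I * x) =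
      Complex.exp (Real.pi * Complex.I * x) * Complex.exp (Real.pi * Complex.I * x) := by
    rw [← Complex.exp_add]; ring_nf
  have h5 : Complex.exp (-(Real.pi * Complex.I * x)) * Complex.exp (Real.pi * Complex.I * x) =
      1 := by rw [← Complex.exp_add, neg_add_cancel, Complex.exp_zero]
  rw [h4, Complex.sin, show -(Real.pi * x) * Complex.I = -(Real.pi * Complex.I * x) by ring,
    show (Real.pi * x) * Complex.I = Real.pi * Complex.I * x by ring]
  linear_combination Complex.I / 2 * Complex.exp (Real.pi * Complex.I * x) * h5

lemma hasProd_row (z : ℂ) (τ : ℍ) (m : ℕ) :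
    HasProd (fun n : ℤ ↦ 1 - z ^ 2 * (halfPoint τ (.inr (m, n)) ^ 2)⁻¹)
      (tripleFactor z τ m /
        (1 - Complex.exp (2 * Real.pi * Complex.I * τ) ^ (m + 1)) ^ 2) := by
  set w : ℂ := ((m : ℂ) + 1) * τ
  convert! hasProd_one_sub_sq_div_sq (w := w)
    (fun n ↦ halfPoint_ne_zero τ (.inr (m, n))) z using 1
  have h1 : Complex.exp (2 * Real.pi * Complex.I * τ) ^ (m + 1) =
      Complex.exp (2 * Real.pi * Complex.I * w) := by
    rw [← Complex.exp_nat_mul]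
    congr 1
    push_cast
    ring
  have h2 : 1 - Complex.exp (2 * Real.pi * Complex.I * w) ≠ 0 := by
    rw [← h1]
    exact one_sub_pow_ne_zero (norm_exp_two_pi_I_mul_lt_one τ) m
  have h3 : Complex.exp (-(Real.pi * Complex.I * (w - z))) *
      Complex.exp (-(Real.pi * Complex.I * (w + z))) =
        Complex.exp (-(Real.pi * Complex.I * w)) ^ 2 := by
    rw [← Complex.exp_add, ← Complex.exp_nat_mul]
    congr 1
    push_cast
    ring
  have h4 : Complex.exp (2 * Real.pi * Complex.I * (w - z)) =
      Complex.exp (-(2 * Real.pi * Complex.I * z)) * Complex.exp (2 * Real.pi * Complex.I * w) := by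
    rw [← Complex.exp_add]; ring_nf
  have h5 : Complex.exp (2 * Real.pi * Complex.I * (w + z)) =
      Complex.exp (2 * Real.pi * Complex.I * z) * Complex.exp (2 * Real.pi * Complex.I * w) := by
    rw [← Complex.exp_add]; ring_nf
  have h6 := Complex.exp_ne_zero (-(Real.pi * Complex.I * w))
  rw [sin_pi_mul_eq, sin_pi_mul_eq, sin_pi_mul_eq, tripleFactor, h1, h4, h5]
  have hI := Complex.I_ne_zero
  rw [div_eq_div_iff (pow_ne_zero 2 h2) (pow_ne_zero 2 (mul_ne_zero
    (mul_ne_zero (div_ne_zero hI two_ne_zero) h6) h2))]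
  linear_combination (-(Complex.I / 2) ^ 2 * (1 - Complex.exp (-(2 * Real.pi * Complex.I * z)) *
    Complex.exp (2 * Real.pi * Complex.I * w)) * (1 - Complex.exp (2 * Real.pi * Complex.I * z) *
    Complex.exp (2 * Real.pi * Complex.I * w)) *
    (1 - Complex.exp (2 * Real.pi * Complex.I * w)) ^ 2) * h3

/-! ### Weierstrass products and regularised generating functions -/

/-- Weierstrass' elementary factor of genus one. -/
def primaryFactor (u : ℂ) : ℂ := (1 - u) * Complex.exp u

/-- From |1 - u|² = 1 + (|u|² - 2 Re u) ≤ exp(|u|² - 2 Re u), the linear term cancels against |exp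
u|. Being valid for all u, this bounds finite products on every circle. -/
lemma norm_primaryFactor_le (u : ℂ) : ‖primaryFactor u‖ ≤ Real.exp (‖u‖ ^ 2 / 2) := by
  have h1 : ‖1 - u‖ ≤ Real.exp (-u.re + ‖u‖ ^ 2 / 2) := by
    refine (pow_le_pow_iff_left₀ (norm_nonneg _) (Real.exp_pos _).le two_ne_zero).mp ?_
    have h2 : ‖1 - u‖ ^ 2 = (-2 * u.re + ‖u‖ ^ 2) + 1 := by
      rw [← Complex.normSq_eq_norm_sq, ← Complex.normSq_eq_norm_sq, Complex.normSq_apply,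
        Complex.normSq_apply]
      simp
      ring
    rw [h2, ← Real.exp_nat_mul]
    refine (Real.add_one_le_exp _).trans (le_of_eq ?_)
    congr 1
    push_cast
    ring
  rw [primaryFactor, norm_mul, Complex.norm_exp]
  calc _ ≤ Real.exp (-u.re + ‖u‖ ^ 2 / 2) * Real.exp u.re := by gcongr
    _ = _ := by rw [← Real.exp_add]; ring_nf

lemma norm_primaryFactor_sub_one_le {u : ℂ} (hu : ‖u‖ ≤ 1) :
    ‖primaryFactor u - 1‖ ≤ 3 * ‖u‖ ^ 2 := by
  have h1 : primaryFactor u - 1 = (1 - u) * (Complex.exp u - 1 - u) - u ^ 2 := by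
    rw [primaryFactor]; ring
  have h2 : ‖1 - u‖ ≤ 2 := (norm_sub_le _ _).trans (by rw [norm_one]; linarith)
  rw [h1]
  refine (norm_sub_le _ _).trans ?_
  rw [norm_mul, norm_pow]
  nlinarith [Complex.norm_exp_sub_one_sub_id_le hu, norm_nonneg (1 - u),
    norm_nonneg (Complex.exp u - 1 - u), sq_nonneg ‖u‖]

lemma multipliable_primaryFactor {ι : Type*} {u : ι → ℂ} (hu : Summable fun a ↦ ‖u a‖ ^ 2) :
    Multipliable fun a ↦ primaryFactor (u a) := by
  have h1 : Summable fun a ↦ ‖primaryFactor (u a) - 1‖ := by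
    refine Summable.of_norm_bounded_eventually (hu.mul_left 3) ?_
    filter_upwards [hu.tendsto_cofinite_zero.eventually (gt_mem_nhds one_pos)] with a ha
    rw [norm_norm]
    refine norm_primaryFactor_sub_one_le ?_
    by_contra h
    nlinarith
  simpa using multipliable_one_add_of_summable h1

/-- The generating series `∑ newtonSeq p k * X ^ k` converges everywhere to `f`. -/
def HasNewtonSum (p : ℕ → ℂ) (f : ℂ → ℂ) : Prop :=
  ∀ X, HasSum (fun k ↦ newtonSeq p k * X ^ k) (f X)

lemma HasNewtonSum.add {p q : ℕ → ℂ} {f g : ℂ → ℂ} (hf : HasNewtonSum p f)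
    (hg : HasNewtonSum q g) : HasNewtonSum (p + q) (f * g) := by
  intro X
  have := hasSum_sum_range_mul_of_summable_norm (hf X).summable.norm (hg X).summable.norm
  rw [(hf X).tsum_eq, (hg X).tsum_eq] at this
  refine this.congr_fun fun k ↦ ?_
  rw [newtonSeq_add, Finset.sum_mul]
  refine Finset.sum_congr rfl fun r hr ↦ ?_
  have : k = r + (k - r) := by have := Finset.mem_range.mp hr; omega
  nth_rw 2 [this]
  rw [pow_add]
  ring

lemma hasNewtonSum_single (c : ℂ) :
    HasNewtonSum (Pi.single 0 c) fun X ↦ Complex.exp (-(c * X)) := by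
  intro X
  have := NormedSpace.expSeries_div_hasSum_exp (-(c * X))
  rw [← Complex.exp_eq_exp_ℂ] at this
  refine this.congr_fun fun k ↦ ?_
  rw [newtonSeq_single, ← neg_mul, mul_pow]
  ring

lemma hasNewtonSum_pow (y : ℂ) : HasNewtonSum (fun i ↦ y ^ (i + 1)) fun X ↦ 1 - y * X := by
  intro X
  have h0 (k : ℕ) : newtonSeq (fun i ↦ y ^ (i + 1)) k =
      PowerSeries.coeff k (1 - PowerSeries.C y * PowerSeries.X) := by
    rw [← mk_newtonSeq_pow, PowerSeries.coeff_mk]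
  have h : 1 - y * X = ∑ k ∈ Finset.range 2, newtonSeq (fun i ↦ y ^ (i + 1)) k * X ^ k := by
    rw [Finset.sum_range_succ, Finset.sum_range_one, h0, h0]
    simp [PowerSeries.coeff_one]
    ring
  show HasSum _ (1 - y * X)
  rw [h]
  refine hasSum_sum_of_ne_finset_zero fun k hk ↦ ?_
  have hk : 2 ≤ k := by
    by_contra h
    exact hk (Finset.mem_range.mpr (not_le.mp h))
  rw [h0]
  obtain ⟨k, rfl⟩ := Nat.exists_eq_add_of_le' hk
  simp [PowerSeries.coeff_one]

lemma hasNewtonSum_sum {ι : Type*} (y : ι → ℂ) (F : Finset ι) :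
    HasNewtonSum (fun i ↦ ∑ a ∈ F, y a ^ (i + 1)) fun X ↦ ∏ a ∈ F, (1 - y a * X) := by
  classical
  induction F using Finset.induction_on with
  | empty =>
    intro X
    have := hasNewtonSum_single 0 X
    simpa using! this
  | insert a F ha ih =>
    convert! (hasNewtonSum_pow (y a)).add ih using 1
    · ext i
      simp [Finset.sum_insert ha]
    · ext X
      simp [Finset.prod_insert ha]

/-- Cauchy's estimate, with the coefficients identified by uniqueness of power series. -/
lemma norm_coeff_mul_pow_le {c : ℕ → ℂ} {f : ℂ → ℂ} (hf : Differentiable ℂ f)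
    (hc : ∀ X, HasSum (fun k ↦ c k * X ^ k) (f X)) {R M : ℝ} (hR : 0 < R)
    (hM : ∀ X, ‖X‖ = R → ‖f X‖ ≤ M) (k : ℕ) : ‖c k‖ * R ^ k ≤ M := by
  have h1 : HasFPowerSeriesAt f (FormalMultilinearSeries.ofScalars ℂ c) 0 := by
    refine hasFPowerSeriesAt_iff.mpr (.of_forall fun X ↦ ?_)
    simpa [FormalMultilinearSeries.coeff_ofScalars, mul_comm] using hc X
  have h2 : HasFPowerSeriesAt f (FormalMultilinearSeries.ofScalars ℂ
      fun k ↦ (k.factorial : ℂ)⁻¹ * iteratedDeriv k f 0) 0 := by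
    refine hasFPowerSeriesAt_iff.mpr (.of_forall fun X ↦ ?_)
    simpa [FormalMultilinearSeries.coeff_ofScalars, mul_left_comm] using
      Complex.hasSum_taylorSeries_of_entire hf 0 X
  have h3 : c k = (k.factorial : ℂ)⁻¹ * iteratedDeriv k f 0 := by
    have := congrArg (fun p ↦ p.coeff k) (h1.eq_formalMultilinearSeries h2)
    simpa [FormalMultilinearSeries.coeff_ofScalars] using this
  have h4 := Complex.norm_iteratedDeriv_le_of_forall_mem_sphere_norm_le
    (f := f) (c := 0) k hR
    hf.diffContOnCl (fun X hX ↦ hM X (by simpa using hX))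
  have h5 : (0 : ℝ) < k.factorial := by exact_mod_cast k.factorial_pos
  rw [h3, norm_mul, norm_inv, Complex.norm_natCast]
  calc _ ≤ (k.factorial : ℝ)⁻¹ * (k.factorial * M / R ^ k) * R ^ k := by gcongr
    _ = M := by field_simp

/-- Power sums in which the first one, which need not converge, is replaced by a given value. -/
def powerSumFrom {ι : Type*} (P : ℂ) (y : ι → ℂ) : ℕ → ℂ
  | 0 => P
  | i + 1 => ∑' a, y a ^ (i + 2)

/-- The generating function of the regularised elementary symmetric functions. -/
lemma hasNewtonSum_powerSumFrom {ι : Type*} (P : ℂ) {y : ι → ℂ}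
    (hy : Summable fun a ↦ ‖y a‖ ^ 2) :
    HasNewtonSum (powerSumFrom P y)
      fun X ↦ Complex.exp (-(P * X)) * ∏' a, primaryFactor (y a * X) := by
  -- The first power sum of F is corrected to be exactly P. This inserts the exponentials of the
  -- primary factors, so convergence needs only the squares of y to be summable.
  let p (F : Finset ι) : ℕ → ℂ :=
    Pi.single 0 (P - ∑ a ∈ F, y a) + fun i ↦ ∑ a ∈ F, y a ^ (i + 1)
  let f (F : Finset ι) (X : ℂ) : ℂ := Complex.exp (-(P * X)) * ∏ a ∈ F, primaryFactor (y a * X)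
  have hp (F) : HasNewtonSum (p F) (f F) := by
    convert! (hasNewtonSum_single (P - ∑ a ∈ F, y a)).add (hasNewtonSum_sum y F) using 1
    ext X
    simp only [f, primaryFactor, Pi.mul_apply]
    rw [Finset.prod_mul_distrib, ← Complex.exp_sum, ← Finset.sum_mul, mul_left_comm,
      ← Complex.exp_add, mul_comm]
    congr 2
    ring
  have hlim (i) : Tendsto (fun F ↦ p F i) atTop (𝓝 (powerSumFrom P y i)) := by
    cases i with
    | zero => simp [p, powerSumFrom]
    | succ i =>
      have h : Summable fun a ↦ (y a) ^ (i + 2) := by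
        refine Summable.of_norm_bounded_eventually hy ?_
        filter_upwards [hy.tendsto_cofinite_zero.eventually (gt_mem_nhds one_pos)] with a ha
        have h2 : ‖y a‖ ≤ 1 := by
          by_contra h
          nlinarith
        rw [norm_pow]
        exact pow_le_pow_of_le_one (norm_nonneg _) h2 (by omega)
      simpa [p, powerSumFrom] using! h.hasSum
  have hbound (R : ℝ) (hR : 0 < R) (F : Finset ι) (k : ℕ) : ‖newtonSeq (p F) k‖ * R ^ k ≤
      Real.exp (‖P‖ * R + R ^ 2 / 2 * ∑' a, ‖y a‖ ^ 2) := by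
    refine norm_coeff_mul_pow_le (f := f F) ?_ (hp F) hR (fun X hX ↦ ?_) k
    · unfold f primaryFactor
      fun_prop
    · rw [norm_mul, Complex.norm_exp, norm_prod, Real.exp_add]
      gcongr
      · refine (Complex.re_le_norm _).trans ?_
        rw [norm_neg, norm_mul, hX]
      · calc ∏ a ∈ F, ‖primaryFactor (y a * X)‖ ≤ ∏ a ∈ F, Real.exp (R ^ 2 / 2 * ‖y a‖ ^ 2) := by
              refine Finset.prod_le_prod (fun _ _ ↦ norm_nonneg _) fun a _ ↦ ?_
              refine (norm_primaryFactor_le _).trans (le_of_eq ?_)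
              rw [norm_mul, hX]
              ring_nf
          _ = Real.exp (R ^ 2 / 2 * ∑ a ∈ F, ‖y a‖ ^ 2) := by
              rw [← Real.exp_sum, Finset.mul_sum]
          _ ≤ _ := by
              gcongr
              exact hy.sum_le_tsum F fun _ _ ↦ by positivity
  intro X
  -- Any radius larger than |X| serves: Cauchy's estimate on it majorises the series by a geometric
  -- one, uniformly in F.
  set R := 2 * ‖X‖ + 1 with hRdef
  have hR : 0 < R := by positivity
  set M := Real.exp (‖P‖ * R + R ^ 2 / 2 * ∑' a, ‖y a‖ ^ 2)
  have hterm (F : Finset ι) (k : ℕ) : ‖newtonSeq (p F) k * X ^ k‖ ≤ M * (‖X‖ / R) ^ k := by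
    rw [norm_mul, norm_pow, div_pow]
    have h1 := hbound R hR F k
    have h2 : 0 < R ^ k := by positivity
    calc _ = ‖newtonSeq (p F) k‖ * R ^ k * (‖X‖ ^ k / R ^ k) := by field_simp
      _ ≤ _ := by gcongr
  have hgeom : Summable fun k : ℕ ↦ M * (‖X‖ / R) ^ k := by
    refine (summable_geometric_of_lt_one (by positivity) ?_).mul_left M
    rw [div_lt_one hR]
    linarith [norm_nonneg X]
  have hlim' (k : ℕ) : Tendsto (fun F ↦ newtonSeq (p F) k * X ^ k) atTop
      (𝓝 (newtonSeq (powerSumFrom P y) k * X ^ k)) :=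
    (tendsto_newtonSeq hlim k).mul_const _
  have hsum : Summable fun k ↦ newtonSeq (powerSumFrom P y) k * X ^ k :=
    hgeom.of_norm_bounded fun k ↦
      le_of_tendsto (hlim' k).norm (.of_forall fun F ↦ hterm F k)
  have h1 := tendsto_tsum_of_dominated_convergence hgeom hlim' (.of_forall hterm)
  simp_rw [fun F ↦ (hp F X).tsum_eq] at h1
  have hmul : Multipliable fun a ↦ primaryFactor (y a * X) := by
    refine multipliable_primaryFactor ((hy.mul_right (‖X‖ ^ 2)).congr fun a ↦ ?_)
    rw [norm_mul, mul_pow]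
  have h2 : Tendsto (fun F ↦ f F X) atTop
      (𝓝 (Complex.exp (-(P * X)) * ∏' a, primaryFactor (y a * X))) :=
    Tendsto.const_mul _ hmul.hasProd
  show HasSum _ (Complex.exp (-(P * X)) * ∏' a, primaryFactor (y a * X))
  rw [← tendsto_nhds_unique h1 h2]
  exact hsum.hasSum

/-! ### The generating function as a theta quotient -/

lemma summable_norm_sq_halfPoint_sq_inv (τ : ℍ) :
    Summable fun a ↦ ‖(halfPoint τ a ^ 2)⁻¹‖ ^ 2 := by
  refine (summable_norm_halfPoint_pow τ (k := 4) (by norm_num)).congr fun a ↦ ?_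
  rw [norm_inv, norm_pow, inv_pow, ← pow_mul]

lemma multipliable_primaryFactor_comp (z : ℂ) (τ : ℍ) {ι : Type*} {g : ι → ℕ ⊕ ℕ × ℤ}
    (hg : g.Injective) :
    Multipliable fun i ↦ primaryFactor ((halfPoint τ (g i) ^ 2)⁻¹ * z ^ 2) := by
  refine multipliable_primaryFactor
    ((((summable_norm_sq_halfPoint_sq_inv τ).comp_injective hg).mul_right
      (‖z ^ 2‖ ^ 2)).congr fun a ↦ ?_)
  rw [norm_mul, mul_pow, Function.comp_apply]

lemma mul_tprod_primaryFactor_inl (z : ℂ) (τ : ℍ) :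
    Real.pi * z * ∏' n, primaryFactor ((halfPoint τ (.inl n) ^ 2)⁻¹ * z ^ 2) =
      Complex.sin (Real.pi * z) *
        Complex.exp ((∑' n : ℕ, (halfPoint τ (.inl n) ^ 2)⁻¹) * z ^ 2) := by
  have hs : Summable fun n : ℕ ↦ (halfPoint τ (.inl n) ^ 2)⁻¹ := by
    have := (summable_nat_add_iff 1).mpr (Complex.summable_one_div_nat_cpow (p := 2) |>.mpr
      (by norm_num))
    refine this.congr fun n ↦ ?_
    rw [Complex.cpow_ofNat]
    simp [halfPoint]
  have h1 := (multipliable_primaryFactor_comp z τ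
    Sum.inl_injective).tendsto_prod_tprod_nat.const_mul (Real.pi * z : ℂ)
  have h2 := (Complex.tendsto_euler_sin_prod z).mul
    ((Complex.continuous_exp.tendsto _).comp (hs.hasSum.tendsto_sum_nat.mul_const (z ^ 2)))
  refine tendsto_nhds_unique h1 (h2.congr fun N ↦ ?_)
  simp only [primaryFactor, Function.comp_apply]
  rw [Finset.prod_mul_distrib, ← Complex.exp_sum, Finset.sum_mul, mul_assoc]
  congr 3
  ext n
  simp [halfPoint, div_eq_inv_mul]

/-- The primary factors make the double product unconditional, so it can be taken row by row. Their
exponentials then accumulate the sum of ω⁻² in Eisenstein's order, matching `halfG2`. -/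
lemma tprod_primaryFactor_inr (z : ℂ) (τ : ℍ) :
    -2 * Complex.sin (Real.pi * z) * Complex.exp (Real.pi * Complex.I * τ / 4) *
      eulerProd (Complex.exp (2 * Real.pi * Complex.I * τ)) *
      ∏' p : ℕ × ℤ, primaryFactor ((halfPoint τ (.inr p) ^ 2)⁻¹ * z ^ 2) =
    theta z τ * (eulerProd (Complex.exp (2 * Real.pi * Complex.I * τ)) ^ 2)⁻¹ *
      Complex.exp ((∑' m : ℕ, ∑' n : ℤ, (halfPoint τ (.inr (m, n)) ^ 2)⁻¹) * z ^ 2) := by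
  have hq := norm_exp_two_pi_I_mul_lt_one τ
  have hrow (m : ℕ) : HasProd
      (fun n : ℤ ↦ primaryFactor ((halfPoint τ (.inr (m, n)) ^ 2)⁻¹ * z ^ 2))
      (tripleFactor z τ m / (1 - Complex.exp (2 * Real.pi * Complex.I * τ) ^ (m + 1)) ^ 2 *
        Complex.exp ((∑' n : ℤ, (halfPoint τ (.inr (m, n)) ^ 2)⁻¹) * z ^ 2)) := by
    have h1 := (hasSum_sq_inv_row τ m).summable.hasSum.mul_right (z ^ 2)
    convert! (hasProd_row z τ m).mul h1.cexp using 2 with n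
    simp [primaryFactor, mul_comm]
  have h1 := (((multipliable_primaryFactor_comp z τ
    Sum.inr_injective).hasProd.prod_fiberwise hrow).tendsto_prod_nat).const_mul
      (-2 * Complex.sin (Real.pi * z) * Complex.exp (Real.pi * Complex.I * τ / 4) *
      eulerProd (Complex.exp (2 * Real.pi * Complex.I * τ)))
  have h2 := ((tendsto_theta z τ).mul (((tendsto_qPoch hq).pow 2).inv₀
    (pow_ne_zero 2 (eulerProd_ne_zero hq)))).mul ((Complex.continuous_exp.tendsto _).comp
      ((hasSum_tsum_sq_inv_row τ).summable.hasSum.tendsto_sum_nat.mul_const (z ^ 2)))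
  refine tendsto_nhds_unique h1 (h2.congr fun N ↦ ?_)
  simp only [Function.comp_apply, qPoch]
  rw [Finset.prod_mul_distrib, ← Complex.exp_sum, Finset.sum_mul, Finset.prod_div_distrib,
    Finset.prod_pow]
  ring

lemma eta_pow_three (τ : ℍ) : ModularForm.eta τ ^ 3 =
    Complex.exp (Real.pi * Complex.I * τ / 4) *
      eulerProd (Complex.exp (2 * Real.pi * Complex.I * τ)) ^ 3 := by
  simp only [ModularForm.eta, ModularForm.eta_q_eq_pow, eulerProd, mul_pow,
    Function.Periodic.qParam]
  rw [← Complex.exp_nat_mul]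
  congr 2
  push_cast
  ring

lemma limitPowerSum_eq (τ : ℍ) : limitPowerSum τ =
    powerSumFrom (halfG2 τ - Real.pi / (2 * τ.im)) fun a ↦ (halfPoint τ a ^ 2)⁻¹ := by
  ext i
  cases i with
  | zero => simp [limitPowerSum, holoPowerSum, powerSumFrom, sub_eq_add_neg]
  | succ i => simp [limitPowerSum, holoPowerSum, powerSumFrom, pow_mul]

lemma hasSum_generatingTerm (z : ℂ) (τ : ℍ) : HasSum (generatingTerm z τ)
    (z * (Complex.exp (-((halfG2 τ - Real.pi / (2 * τ.im)) * z ^ 2)) *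
      ∏' a, primaryFactor ((halfPoint τ a ^ 2)⁻¹ * z ^ 2))) := by
  have h := (hasNewtonSum_powerSumFrom (halfG2 τ - Real.pi / (2 * τ.im))
    (summable_norm_sq_halfPoint_sq_inv τ) (z ^ 2)).mul_left z
  refine h.congr_fun fun k ↦ ?_
  rw [generatingTerm, e_eq_newtonSeq, limitPowerSum_eq, ← mul_assoc, ← mul_pow]
  ring_nf

/-- The Gaussian in `phi` removes exactly the term -π/(2v) of the first power sum, so nothing
nonholomorphic in τ remains. -/
lemma phi_eq_mul_tprod (z : ℂ) (τ : ℍ) : phi z τ = z * Complex.exp (-(halfG2 τ * z ^ 2)) *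
    ∏' a, primaryFactor ((halfPoint τ a ^ 2)⁻¹ * z ^ 2) := by
  rw [phi, (hasSum_generatingTerm z τ).tsum_eq, mul_left_comm, ← mul_assoc (Complex.exp _),
    ← Complex.exp_add, mul_assoc]
  congr 4
  ring

/-- The generating function is the theta function divided by `-2πη³`. -/
lemma phi_eq_theta_div (z : ℂ) (τ : ℍ) :
    phi z τ = theta z τ / (-2 * Real.pi * ModularForm.eta τ ^ 3) := by
  have hpi : (Real.pi : ℂ) ≠ 0 := Complex.ofReal_ne_zero.mpr Real.pi_ne_zero
  have hE := eulerProd_ne_zero (norm_exp_two_pi_I_mul_lt_one τ)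
  have hprod : ∏' a, primaryFactor ((halfPoint τ a ^ 2)⁻¹ * z ^ 2) =
      (∏' n, primaryFactor ((halfPoint τ (.inl n) ^ 2)⁻¹ * z ^ 2)) *
        ∏' p, primaryFactor ((halfPoint τ (.inr p) ^ 2)⁻¹ * z ^ 2) :=
    (multipliable_primaryFactor_comp z τ Sum.inl_injective).tprod_sum
      (multipliable_primaryFactor_comp z τ Sum.inr_injective)
  have h1 := mul_tprod_primaryFactor_inl z τ
  have h2 := tprod_primaryFactor_inr z τ
  rw [eta_pow_three, eq_div_iff (by simp [hpi, hE]), phi_eq_mul_tprod, hprod, halfG2, add_mul,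
    neg_add, Complex.exp_add]
  set A := ∑' n : ℕ, (halfPoint τ (.inl n) ^ 2)⁻¹
  set R := ∑' m : ℕ, ∑' n : ℤ, (halfPoint τ (.inr (m, n)) ^ 2)⁻¹
  set P := ∏' n, primaryFactor ((halfPoint τ (.inl n) ^ 2)⁻¹ * z ^ 2)
  set Q := ∏' p, primaryFactor ((halfPoint τ (.inr p) ^ 2)⁻¹ * z ^ 2)
  set E := eulerProd (Complex.exp (2 * Real.pi * Complex.I * τ))
  set x := Complex.exp (Real.pi * Complex.I * τ / 4)
  have hA : Complex.exp (-(A * z ^ 2)) * Complex.exp (A * z ^ 2) = 1 := by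
    rw [← Complex.exp_add]; simp
  have hR : Complex.exp (-(R * z ^ 2)) * Complex.exp (R * z ^ 2) = 1 := by
    rw [← Complex.exp_add]; simp
  calc _ = (Real.pi * z * P) * Complex.exp (-(A * z ^ 2)) * (-2 * x * E * Q) *
        Complex.exp (-(R * z ^ 2)) * E ^ 2 := by ring
    _ = (Complex.exp (-(A * z ^ 2)) * Complex.exp (A * z ^ 2)) *
        (-2 * Complex.sin (Real.pi * z) * x * E * Q) * Complex.exp (-(R * z ^ 2)) * E ^ 2 := by
      rw [h1]; ring
    _ = theta z τ * ((E ^ 2)⁻¹ * E ^ 2) *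
        (Complex.exp (-(R * z ^ 2)) * Complex.exp (R * z ^ 2)) := by rw [hA, h2]; ring
    _ = _ := by rw [hR, inv_mul_cancel₀ (pow_ne_zero 2 hE)]; ring

/-! ### Modular transformation laws -/

lemma symmSum_image_mul {c : ℂ} (hc : c ≠ 0) (S : Set ℂ) (k : ℕ) :
    symmSum ((fun x ↦ c * x) '' S) k = (c⁻¹) ^ k * symmSum S k := by
  let E : {T : Finset ℂ // T.card = k ∧ (T : Set ℂ) ⊆ S} ≃
      {T : Finset ℂ // T.card = k ∧ (T : Set ℂ) ⊆ (fun x ↦ c * x) '' S} :=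
    (Equiv.mulLeft₀ c hc).finsetCongr.subtypeEquiv fun T ↦ by
      simp [Set.image_subset_image_iff (mul_right_injective₀ hc)]
  rw [symmSum, symmSum, ← E.tsum_eq, ← tsum_mul_left]
  refine tsum_congr fun T ↦ ?_
  have : (c⁻¹) ^ k = ∏ x ∈ T.1, c⁻¹ := by rw [Finset.prod_const, T.2.1]
  rw [reciprocalTerm, reciprocalTerm, this, ← Finset.prod_mul_distrib]
  simp [E, mul_comm]

lemma moebius_denom_ne_zero (γ : SL(2, ℤ)) (τ : ℍ) : (γ 1 0 : ℂ) * τ + (γ 1 1 : ℂ) ≠ 0 := by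
  simpa [UpperHalfPlane.denom] using UpperHalfPlane.denom_ne_zero γ τ

lemma coe_smul_eq (γ : SL(2, ℤ)) (τ : ℍ) : ((γ • τ : ℍ) : ℂ) =
    ((γ 0 0 : ℂ) * τ + (γ 0 1 : ℂ)) / ((γ 1 0 : ℂ) * τ + (γ 1 1 : ℂ)) := by
  rw [UpperHalfPlane.coe_specialLinearGroup_apply]
  simp

lemma mem_lattice_smul_iff (γ : SL(2, ℤ)) (τ : ℍ) (w : ℂ) : w ∈ lattice (γ • τ) ↔
    ((γ 1 0 : ℂ) * τ + (γ 1 1 : ℂ)) * w ∈ lattice τ := by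
  have hj := moebius_denom_ne_zero γ τ
  have hdet : (γ 0 0 : ℂ) * γ 1 1 - γ 0 1 * γ 1 0 = 1 := by
    exact_mod_cast (Matrix.det_fin_two γ.1).symm.trans γ.2
  constructor
  · rintro ⟨m, n, rfl⟩
    refine ⟨m * γ 1 1 + n * γ 0 1, m * γ 1 0 + n * γ 0 0, ?_⟩
    rw [coe_smul_eq]
    push_cast
    field_simp
    ring
  · rintro ⟨m, n, h⟩
    refine ⟨γ 0 0 * m - γ 0 1 * n, γ 1 1 * n - γ 1 0 * m, ?_⟩
    have hmul {j : ℂ} (hj : j ≠ 0) (p q w : ℂ) : j * (p + q * (w / j)) = p * j + q * w := by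
      field_simp
    refine mul_left_cancel₀ hj (h.trans ?_)
    rw [coe_smul_eq, hmul hj]
    push_cast
    linear_combination (-(m : ℂ) - n * τ) * hdet

/-- With j = cτ + d the lattice of γτ is j⁻¹ times that of τ, and ω ↦ ω²|ω|^{2s} is multiplicative.
-/
lemma latticePowers_smul (γ : SL(2, ℤ)) (τ : ℍ) (s : ℝ) : latticePowers (γ • τ) s =
    (fun x ↦ (((γ 1 0 : ℂ) * τ + (γ 1 1 : ℂ)) ^ 2 *
      ((‖(γ 1 0 : ℂ) * τ + (γ 1 1 : ℂ)‖ ^ (2 * s) : ℝ) : ℂ))⁻¹ * x) '' latticePowers τ s := by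
  have hj := moebius_denom_ne_zero γ τ
  set j := (γ 1 0 : ℂ) * τ + (γ 1 1 : ℂ)
  have hj' : ((‖j‖ ^ (2 * s) : ℝ) : ℂ) ≠ 0 :=
    Complex.ofReal_ne_zero.mpr (Real.rpow_pos_of_pos (norm_pos_iff.mpr hj) _).ne'
  have key (w : ℂ) : w ^ 2 * ((‖w‖ ^ (2 * s) : ℝ) : ℂ) =
      (j ^ 2 * ((‖j‖ ^ (2 * s) : ℝ) : ℂ))⁻¹ * ((j * w) ^ 2 * ((‖j * w‖ ^ (2 * s) : ℝ) : ℂ)) := by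
    rw [norm_mul, Real.mul_rpow (norm_nonneg _) (norm_nonneg _)]
    push_cast at hj' ⊢
    field_simp
  ext x
  constructor
  · rintro ⟨w, hw, hw0, rfl⟩
    exact ⟨_, ⟨j * w, (mem_lattice_smul_iff γ τ w).mp hw, mul_ne_zero hj hw0, rfl⟩, (key w).symm⟩
  · rintro ⟨_, ⟨w, hw, hw0, rfl⟩, rfl⟩
    have hw' : j * (j⁻¹ * w) = w := mul_inv_cancel_left₀ hj w
    refine ⟨j⁻¹ * w, (mem_lattice_smul_iff γ τ _).mpr ?_, mul_ne_zero (inv_ne_zero hj) hw0, ?_⟩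
    · rwa [hw']
    · rw [key (j⁻¹ * w), hw']

lemma tendsto_symmSum_e (k : ℕ) (τ : ℍ) :
    Tendsto (fun s : ℝ ↦ symmSum (latticePowers τ s) k) (𝓝[>] 0) (𝓝 (e k τ)) := by
  rw [e_eq_newtonSeq]
  exact tendsto_symmSum k τ

/-- For s > 0 the dilation contributes (j²|j|^{2s})^k, and |j|^{2s} → 1. This is why the limit,
unlike Eisenstein's ordering, is exactly modular. -/
lemma e_smul (k : ℕ) (γ : SL(2, ℤ)) (τ : ℍ) :
    e k (γ • τ) = ((γ 1 0 : ℂ) * τ + (γ 1 1 : ℂ)) ^ (2 * k) * e k τ := by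
  have hj := moebius_denom_ne_zero γ τ
  have h1 := tendsto_symmSum_e k (γ • τ)
  simp_rw [latticePowers_smul] at h1
  set j := (γ 1 0 : ℂ) * τ + (γ 1 1 : ℂ)
  have hj0 : 0 < ‖j‖ := norm_pos_iff.mpr hj
  have h2 : Tendsto (fun s : ℝ ↦ ((‖j‖ ^ (2 * s) : ℝ) : ℂ)) (𝓝[>] 0) (𝓝 1) := by
    have : ContinuousAt (fun s : ℝ ↦ ((‖j‖ ^ (2 * s) : ℝ) : ℂ)) 0 :=
      Complex.continuous_ofReal.continuousAt.comp
        ((Real.continuousAt_const_rpow hj0.ne').comp (by fun_prop))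
    have h := this.tendsto.mono_left (nhdsWithin_le_nhds (s := Set.Ioi 0))
    simpa using h
  have h3 := ((h2.const_mul (j ^ 2)).pow k).mul (tendsto_symmSum_e k τ)
  rw [mul_one, ← pow_mul] at h3
  refine tendsto_nhds_unique h1 (h3.congr fun s ↦ ?_)
  rw [symmSum_image_mul, inv_inv]
  exact inv_ne_zero (mul_ne_zero (pow_ne_zero 2 hj)
    (Complex.ofReal_ne_zero.mpr (Real.rpow_pos_of_pos hj0 _).ne'))

lemma isAlmostHolomorphicModularForm_e (k : ℕ) :
    IsAlmostHolomorphicModularForm (2 * k) k (e k) := by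
  refine ⟨fun γ τ ↦ ?_, depthCoeff k, fun r ↦ (depthCoeff_mem k r).1,
    fun r ↦ (depthCoeff_mem k r).2, depthCoeff_self_ne_zero k, e_eq_sum k⟩
  rw [e_smul]
  norm_cast

lemma generatingTerm_smul (γ : SL(2, ℤ)) (z : ℂ) (τ : ℍ) (k : ℕ) :
    generatingTerm (z / ((γ 1 0 : ℂ) * τ + (γ 1 1 : ℂ))) (γ • τ) k =
      ((γ 1 0 : ℂ) * τ + (γ 1 1 : ℂ))⁻¹ * generatingTerm z τ k := by
  have hj := moebius_denom_ne_zero γ τ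
  rw [generatingTerm, generatingTerm, e_smul]
  generalize (γ 1 0 : ℂ) * τ + (γ 1 1 : ℂ) = j at hj
  rw [div_pow, pow_succ j]
  field_simp

lemma phi_smul (γ : SL(2, ℤ)) (z : ℂ) (τ : ℍ) :
    phi (z / ((γ 1 0 : ℂ) * τ + (γ 1 1 : ℂ))) (γ • τ) =
      ((γ 1 0 : ℂ) * τ + (γ 1 1 : ℂ))⁻¹ *
        Complex.exp (Real.pi * Complex.I * (γ 1 0 : ℂ) * z ^ 2 /
          ((γ 1 0 : ℂ) * τ + (γ 1 1 : ℂ))) * phi z τ := by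
  have hj := moebius_denom_ne_zero γ τ
  have him : (τ.im : ℂ) ≠ 0 := Complex.ofReal_ne_zero.mpr τ.im_ne_zero
  -- This is Im(γτ)|j|² = v with the conjugate of j = cτ + d written as j - 2icv. The term 2icv
  -- produces the exponential factor of index ½.
  have hv : ((γ • τ).im : ℂ) * (((γ 1 0 : ℂ) * τ + (γ 1 1 : ℂ)) *
      ((γ 1 0 : ℂ) * τ + (γ 1 1 : ℂ) - 2 * Complex.I * γ 1 0 * τ.im)) = τ.im := by
    have h1 := ModularGroup.im_smul_eq_div_normSq γ τ
    have h2 : (Complex.normSq ((γ 1 0 : ℂ) * τ + (γ 1 1 : ℂ)) : ℂ) =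
        ((γ 1 0 : ℂ) * τ + (γ 1 1 : ℂ)) *
          ((γ 1 0 : ℂ) * τ + (γ 1 1 : ℂ) - 2 * Complex.I * γ 1 0 * τ.im) := by
      rw [← Complex.mul_conj]
      congr 1
      apply Complex.ext <;> simp
      ring
    rw [← h2, h1]
    have h3 : Complex.normSq (UpperHalfPlane.denom γ τ) =
      Complex.normSq ((γ 1 0 : ℂ) * τ + (γ 1 1 : ℂ)) := by simp [UpperHalfPlane.denom]
    rw [h3]
    push_cast
    rw [div_mul_cancel₀]
    exact Complex.ofReal_ne_zero.mpr (Complex.normSq_pos.mpr hj).ne'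
  simp_rw [phi, generatingTerm_smul, tsum_mul_left]
  set j := (γ 1 0 : ℂ) * τ + (γ 1 1 : ℂ)
  have hv0 : ((γ • τ).im : ℂ) ≠ 0 := Complex.ofReal_ne_zero.mpr (γ • τ).im_ne_zero
  have hexp : Complex.exp (-(Real.pi * (z / j) ^ 2 / (2 * ((γ • τ).im : ℂ)))) =
      Complex.exp (Real.pi * Complex.I * (γ 1 0 : ℂ) * z ^ 2 / j) *
        Complex.exp (-(Real.pi * z ^ 2 / (2 * (τ.im : ℂ)))) := by
    rw [← Complex.exp_add]
    congr 1
    field_simp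
    linear_combination z ^ 2 * hv
  rw [hexp]
  ring

/-! ### The lowering operator -/

/-- The value of `-2iv² ∂/∂τ̄` on a real derivative. -/
lemma lowering_eq {F : ℍ → ℂ} {τ : ℍ} {A : ℂ →L[ℝ] ℂ} (h : HasFDerivAt (extend F) A (τ : ℂ)) :
    lowering F τ = -2 * Complex.I * (τ.im : ℂ) ^ 2 * ((A 1 + Complex.I * A Complex.I) / 2) := by
  rw [lowering, dbar, h.fderiv]

lemma differentiableAt_extend {f : ℍ → ℂ} (hf : MDifferentiable 𝓘(ℂ) 𝓘(ℂ) f) (τ : ℍ) :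
    DifferentiableAt ℂ (extend f) (τ : ℂ) :=
  UpperHalfPlane.mdifferentiableAt_iff.mp (hf τ)

lemma hasFDerivAt_one_div_im_pow (τ : ℍ) (r : ℕ) :
    HasFDerivAt (fun w : ℂ ↦ (1 / (w.im : ℂ)) ^ r)
      ((-(r : ℂ) * (1 / (τ.im : ℂ)) ^ (r + 1)) • (Complex.ofRealCLM.comp Complex.imCLM))
      (τ : ℂ) := by
  have him : (τ.im : ℂ) ≠ 0 := Complex.ofReal_ne_zero.mpr τ.im_ne_zero
  have h1 : HasDerivAt (fun x : ℂ ↦ (1 / x) ^ r) (-(r : ℂ) * (1 / (τ.im : ℂ)) ^ (r + 1))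
      (τ.im : ℂ) := by
    have := (hasDerivAt_inv him).pow r
    simp only [one_div]
    convert! this using 1
    cases r with
    | zero => simp
    | succ r => field_simp; simp; rw [add_assoc, pow_add]; field_simp
  have h2 := (h1.hasFDerivAt.restrictScalars ℝ).comp (τ : ℂ)
    (Complex.ofRealCLM.comp Complex.imCLM).hasFDerivAt
  convert! h2 using 1
  ext x
  simp [mul_comm (x.im : ℂ)]

/-- Since L(f v^{-r}) = -r f v^{1-r} for holomorphic f, comparing coefficients of 1/v turns the
lowering relation into this recursion. -/
lemma depthCoeff_succ_succ {k r : ℕ} (h : r ≤ k) (τ : ℍ) :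
    -((r + 1 : ℕ) : ℂ) * depthCoeff (k + 1) (r + 1) τ = Real.pi / 2 * depthCoeff k r τ := by
  have h0 : ((r + 1 : ℕ) : ℂ) ≠ 0 := Nat.cast_ne_zero.mpr r.succ_ne_zero
  have h1 : (r.factorial : ℂ) ≠ 0 := Nat.cast_ne_zero.mpr r.factorial_ne_zero
  simp only [depthCoeff, h, Nat.add_le_add_iff_right, if_true, Nat.factorial_succ,
    Nat.add_sub_add_right, Nat.cast_mul]
  field_simp
  ring

lemma hasFDerivAt_extend_e (k : ℕ) (τ : ℍ) : ∃ A : ℂ →L[ℝ] ℂ,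
    HasFDerivAt (extend (e (k + 1))) A (τ : ℂ) ∧
      -2 * Complex.I * (τ.im : ℂ) ^ 2 * ((A 1 + Complex.I * A Complex.I) / 2) =
        Real.pi / 2 * e k τ := by
  have him : (τ.im : ℂ) ≠ 0 := Complex.ofReal_ne_zero.mpr τ.im_ne_zero
  have hext : extend (e (k + 1)) =ᶠ[𝓝 (τ : ℂ)] fun w ↦ ∑ r ∈ Finset.range (k + 1 + 1),
      extend (depthCoeff (k + 1) r) w * (1 / (w.im : ℂ)) ^ r := by
    filter_upwards [UpperHalfPlane.isOpen_upperHalfPlaneSet.mem_nhds τ.2] with w hw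
    simp only [extend, e_eq_sum, UpperHalfPlane.ofComplex_apply_of_im_pos hw]
    rfl
  let A (r : ℕ) : ℂ →L[ℝ] ℂ := extend (depthCoeff (k + 1) r) τ •
      (-(r : ℂ) * (1 / (τ.im : ℂ)) ^ (r + 1)) • (Complex.ofRealCLM.comp Complex.imCLM) +
    (1 / (τ.im : ℂ)) ^ r • (ContinuousLinearMap.toSpanSingleton ℂ
      (deriv (extend (depthCoeff (k + 1) r)) τ)).restrictScalars ℝ
  have hder (r : ℕ) : HasFDerivAt
      (fun w : ℂ ↦ extend (depthCoeff (k + 1) r) w * (1 / (w.im : ℂ)) ^ r) (A r) (τ : ℂ) :=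
    ((differentiableAt_extend (depthCoeff_mem (k + 1) r).1
      τ).hasDerivAt.hasFDerivAt.restrictScalars ℝ).mul (hasFDerivAt_one_div_im_pow τ r)
  -- The holomorphic coefficient contributes f'(1 + i²) = 0, so only the power of 1/v is
  -- differentiated.
  have hval (r : ℕ) : -2 * Complex.I * (τ.im : ℂ) ^ 2 * ((A r 1 + Complex.I * A r Complex.I) / 2) =
      -(r : ℂ) * depthCoeff (k + 1) r τ * ((τ.im : ℂ) ^ 2 * (1 / (τ.im : ℂ)) ^ (r + 1)) := by
    have hext0 : extend (depthCoeff (k + 1) r) τ = depthCoeff (k + 1) r τ := by simp [extend]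
    simp only [A, hext0, add_apply, smul_apply]
    simp
    linear_combination ((τ.im : ℂ) ^ 2 * (Complex.I * ((τ.im : ℂ) ^ r)⁻¹ *
      deriv (extend (depthCoeff (k + 1) r)) τ -
      r * depthCoeff (k + 1) r τ * ((τ.im : ℂ) ^ (r + 1))⁻¹)) * Complex.I_sq
  refine ⟨∑ r ∈ Finset.range (k + 1 + 1), A r,
    (HasFDerivAt.fun_sum fun r _ ↦ hder r).congr_of_eventuallyEq hext, ?_⟩
  rw [sum_apply, sum_apply, Finset.mul_sum, ← Finset.sum_add_distrib, Finset.sum_div,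
    Finset.mul_sum, Finset.sum_congr rfl fun r _ ↦ hval r, Finset.sum_range_succ', e_eq_sum,
    Finset.mul_sum]
  simp only [Nat.cast_zero, neg_zero, zero_mul, add_zero]
  refine Finset.sum_congr rfl fun r hr ↦ ?_
  rw [depthCoeff_succ_succ (Nat.lt_succ_iff.mp (Finset.mem_range.mp hr)) τ]
  simp only [one_div, inv_pow]
  field_simp
  ring

/-! ### Holomorphy, elliptic law and Fourier expansion -/

lemma theta_eq_jacobiTheta₂ (z : ℂ) (τ : ℍ) : theta z τ =
    Complex.exp (Real.pi * Complex.I * τ / 4 - Real.pi * Complex.I * (z + 1 / 2)) *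
      jacobiTheta₂ (z + 1 / 2 - τ / 2) τ := by
  simp_rw [theta_eq_tsum_tripleTerm, tripleTerm_eq_jacobiTheta₂_term, jacobiTheta₂]

lemma differentiableOn_phi : DifferentiableOn ℂ
    (fun p : ℂ × ℂ ↦ phi p.1 (UpperHalfPlane.ofComplex p.2)) {p | 0 < p.2.im} := by
  have h : DifferentiableOn ℂ (fun p : ℂ × ℂ ↦
      Complex.exp (Real.pi * Complex.I * p.2 / 4 - Real.pi * Complex.I * (p.1 + 1 / 2)) *
        jacobiTheta₂ (p.1 + 1 / 2 - p.2 / 2) p.2 / (-2 * Real.pi * ModularForm.eta p.2 ^ 3))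
      {p | 0 < p.2.im} := by
    intro p hp
    have h1 : DifferentiableAt ℂ (fun p : ℂ × ℂ ↦ jacobiTheta₂ (p.1 + 1 / 2 - p.2 / 2) p.2) p :=
      (hasFDerivAt_jacobiTheta₂ _ hp).differentiableAt.comp p
        (f := fun p : ℂ × ℂ ↦ (p.1 + 1 / 2 - p.2 / 2, p.2)) (by fun_prop)
    have h2 : DifferentiableAt ℂ (fun p : ℂ × ℂ ↦ ModularForm.eta p.2) p :=
      (ModularForm.differentiableAt_eta_of_mem_upperHalfPlaneSet hp).comp p differentiableAt_snd
    have h3 : -2 * Real.pi * ModularForm.eta p.2 ^ 3 ≠ 0 := by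
      simp [ModularForm.eta_ne_zero (z := p.2) hp]
    refine DifferentiableAt.differentiableWithinAt ?_
    fun_prop (disch := assumption)
  refine h.congr fun p hp ↦ ?_
  rw [phi_eq_theta_div, theta_eq_jacobiTheta₂, UpperHalfPlane.ofComplex_apply_of_im_pos hp]

lemma theta_add (l μ : ℤ) (z : ℂ) (τ : ℍ) : theta (z + l * (τ : ℂ) + μ) τ =
    (-1 : ℂ) ^ (μ + l) *
      Complex.exp (-(Real.pi * Complex.I * (l ^ 2 * (τ : ℂ) + 2 * l * z))) * theta z τ := by
  -- Shifting the index by -l completes the square: with a = n + ½, (a - l)²/2 + l(a - l) = a²/2 -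
  -- l²/2.
  rw [theta, theta, ← (Equiv.addRight (-l)).tsum_eq, ← tsum_mul_left]
  refine tsum_congr fun n ↦ ?_
  have h1 : (-1 : ℂ) ^ (μ + l) =
      Complex.exp (Real.pi * Complex.I * (μ - l) + (n - l) * μ * (2 * Real.pi * Complex.I)) := by
    have h2 : Complex.exp ((n - l) * μ * (2 * Real.pi * Complex.I)) = 1 := by
      exact_mod_cast Complex.exp_int_mul_two_pi_mul_I ((n - l) * μ)
    have h3 : Complex.exp (-(2 * Real.pi * Complex.I * l)) = 1 := by
      rw [Complex.exp_eq_one_iff]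
      exact ⟨-l, by push_cast; ring⟩
    rw [Complex.exp_add, h2, mul_one, ← Complex.exp_pi_mul_I, ← Complex.exp_int_mul, ← mul_one
      (Complex.exp _), ← h3, ← Complex.exp_add]
    congr 1
    push_cast
    ring
  rw [h1, ← Complex.exp_add, ← Complex.exp_add, ← Complex.exp_add, ← Complex.exp_add]
  congr 1
  simp only [Equiv.coe_addRight]
  push_cast
  ring

/-- The triangular number `l (l + 1) / 2`. -/
def triangular (l : ℤ) : ℕ := (l * (l + 1) / 2).toNat

lemma two_mul_triangular (l : ℤ) : 2 * (triangular l : ℤ) = l * (l + 1) := by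
  have h0 : 0 ≤ l * (l + 1) := by
    rcases le_or_gt 0 l with h | h
    · positivity
    · exact mul_nonneg_of_nonpos_of_nonpos h.le h
  rw [triangular, Int.toNat_of_nonneg (Int.ediv_nonneg h0 two_pos.le),
    Int.mul_ediv_cancel' (Int.even_mul_succ_self l).two_dvd]

lemma exists_hasSum_inv_eulerProd_pow : ∃ a : ℕ → ℂ, ∀ q : ℂ, ‖q‖ < 1 →
    HasSum (fun m ↦ a m * q ^ m) ((-2 * Real.pi * eulerProd q ^ 3)⁻¹) := by
  have hd : DifferentiableOn ℂ (fun q ↦ (-2 * Real.pi * eulerProd q ^ 3)⁻¹)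
      (Metric.ball (0 : ℂ) 1) := by
    refine DifferentiableOn.inv
      ((ModularForm.differentiableOn_tprod_one_sub_pow.fun_pow 3).const_mul _) fun q hq ↦ ?_
    simpa using! eulerProd_ne_zero (by simpa using hq)
  refine ⟨fun m ↦ (m.factorial : ℂ)⁻¹ *
    iteratedDeriv m (fun q ↦ (-2 * Real.pi * eulerProd q ^ 3)⁻¹) 0, fun q hq ↦ ?_⟩
  have := Complex.hasSum_taylorSeries_on_ball hd (z := q) (by simpa using hq)
  refine this.congr_fun fun m ↦ ?_
  simp only [sub_zero, smul_eq_mul]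
  ring

lemma summable_theta (z : ℂ) (τ : ℍ) : Summable fun n : ℤ ↦
    Complex.exp (2 * Real.pi * Complex.I * ((n : ℂ) + 1 / 2) * (z + 1 / 2)) *
      Complex.exp (2 * Real.pi * Complex.I * (τ : ℂ) * (((n : ℂ) + 1 / 2) ^ 2 / 2)) := by
  have := ((summable_jacobiTheta₂_term_iff (z + 1 / 2 + τ / 2) τ).mpr τ.im_pos).mul_left
    (Complex.exp (Real.pi * Complex.I * (z + 1 / 2 + τ / 4)))
  refine this.congr fun n ↦ ?_
  rw [jacobiTheta₂_term, ← Complex.exp_add, ← Complex.exp_add]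
  congr 1
  ring

lemma hasSum_mul_prod {ι κ : Type*} {f : ι → ℂ} {g : κ → ℂ} {x y : ℂ} (hf : HasSum f x)
    (hg : HasSum g y) : HasSum (fun p : ι × κ ↦ f p.1 * g p.2) (x * y) :=
  hf.mul hg (summable_mul_of_summable_norm hf.summable.norm hg.summable.norm)

/-- As (l + ½)²/2 = l(l + 1)/2 + 1/8, the factor q^{1/8} of ϑ cancels that of η³. What remains is a
theta series in integral powers of q times the Taylor series of (-2π∏(1 - q^n)³)⁻¹. -/
lemma exists_fourier_phi : ∃ c : ℕ → ℤ → ℂ,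
    (∀ (n : ℕ) (l : ℤ), c n l ≠ 0 → l * (l + 1) ≤ 2 * (n : ℤ)) ∧
    ∀ (z : ℂ) (τ : ℍ), HasSum
      (fun p : ℕ × ℤ ↦ c p.1 p.2 * Complex.exp (2 * Real.pi * Complex.I * p.1 * (τ : ℂ)) *
        Complex.exp (2 * Real.pi * Complex.I * ((p.2 : ℂ) + 1 / 2) * z)) (phi z τ) := by
  obtain ⟨a, ha⟩ := exists_hasSum_inv_eulerProd_pow
  refine ⟨fun n l ↦ if triangular l ≤ n then
    a (n - triangular l) * Complex.exp (Real.pi * Complex.I * (l + 1 / 2)) else 0,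
    fun n l h ↦ ?_, fun z τ ↦ ?_⟩
  · have h1 : triangular l ≤ n := by
      by_contra h1
      simp [h1] at h
    rw [← two_mul_triangular]
    exact_mod_cast Nat.mul_le_mul_left 2 h1
  · have h1 := ha _ (norm_exp_two_pi_I_mul_lt_one τ)
    have h2 := (summable_theta z τ).hasSum.mul_right (Complex.exp (-(Real.pi * Complex.I * τ / 4)))
    have h3 := hasSum_mul_prod h1 h2
    -- The product of the two series is indexed by (m, l) and contributes to q^{m + l(l+1)/2}. The
    -- shift is injective and misses exactly the pairs where c vanishes by definition.
    let g (p : ℕ × ℤ) : ℕ × ℤ := (p.1 + triangular p.2, p.2)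
    have hg : g.Injective := by
      rintro ⟨m, l⟩ ⟨m', l'⟩ h
      simp only [g, Prod.mk.injEq] at h
      obtain ⟨h, rfl⟩ := h
      simpa using h
    refine (hg.hasSum_iff ?_).mp ?_
    · rintro ⟨n, l⟩ h
      have : ¬ triangular l ≤ n := fun h' ↦ h ⟨(n - triangular l, l), by simp [g, h']⟩
      simp [this]
    · rw [phi_eq_theta_div, theta, eta_pow_three]
      convert! h3 using 1
      · ext ⟨m, l⟩
        have h4 : 2 * (triangular l : ℂ) = l * (l + 1) := by exact_mod_cast two_mul_triangular l
        simp only [g, Function.comp_apply, Nat.le_add_left, if_true, Nat.add_sub_cancel,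
          ← Complex.exp_nat_mul]
        simp only [mul_assoc (a m), ← Complex.exp_add]
        congr 2
        push_cast
        linear_combination (Real.pi * Complex.I * τ) * h4
      · rw [Complex.exp_neg, div_eq_mul_inv]
        simp only [mul_inv]
        ring

lemma isWeakJacobiForm_phi : IsWeakJacobiForm (-1) 1 phi where
  holomorphic := differentiableOn_phi
  modular γ z τ := by
    rw [phi_smul, zpow_neg_one]
    congr 3
    push_cast
    ring
  elliptic := by
    -- Here ε = 1, since translation by τ also changes the sign of ϑ.
    refine ⟨1, .inr rfl, fun l μ z τ ↦ ?_⟩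
    rw [phi_eq_theta_div, phi_eq_theta_div, theta_add, ← mul_div_assoc]
    congr 4
    · push_cast; ring
    · push_cast; ring
  fourier := by
    obtain ⟨c, hc, h⟩ := exists_fourier_phi
    refine ⟨c, fun n l hnl ↦ ?_, fun z τ ↦ by simpa using h z τ⟩
    have := hc n l hnl
    have : (l : ℝ) * (l + 1) ≤ 2 * n := by exact_mod_cast this
    push_cast
    linarith

end LatticeEisenstein

end

open LatticeEisenstein in
theorem theorem1p1 :
    -- the defining sums converge absolutely for `s > 0`, and their limit as `s → 0⁺` exists
    (∀ (k : ℕ) (τ : ℍ),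
      (∀ s : ℝ, 0 < s → Summable (reciprocalTerm (latticePowers τ s) k)) ∧
      Tendsto (fun s : ℝ ↦ symmSum (latticePowers τ s) k) (𝓝[>] 0) (𝓝 (e k τ))) ∧
    -- modularity, with exact depth
    (∀ k : ℕ, IsAlmostHolomorphicModularForm (2 * k) k (e k)) ∧
    -- the lowering operator
    ((∀ τ : ℍ, e 0 τ = 1) ∧
      ∀ (k : ℕ) (τ : ℍ), DifferentiableAt ℝ (extend (e (k + 1))) (τ : ℂ) ∧
        lowering (e (k + 1)) τ = Real.pi / 2 * e k τ) ∧
    -- the generating function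
    ((∀ (z : ℂ) (τ : ℍ), Summable (generatingTerm z τ)) ∧
      IsWeakJacobiForm (-1) 1 phi ∧
      ∀ (z : ℂ) (τ : ℍ), phi z τ = theta z τ / (-2 * Real.pi * ModularForm.eta τ ^ 3)) := by
  refine ⟨fun k τ ↦ ⟨fun s hs ↦ (hasSum_reciprocalTerm_latticePowers τ hs k).summable,
    tendsto_symmSum_e k τ⟩, isAlmostHolomorphicModularForm_e, ⟨fun τ ↦ ?_, fun k τ ↦ ?_⟩,
    fun z τ ↦ (hasSum_generatingTerm z τ).summable, isWeakJacobiForm_phi, phi_eq_theta_div⟩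
  · simp [e_eq_newtonSeq, newtonSeq_zero]
  · obtain ⟨A, hA, h⟩ := hasFDerivAt_extend_e k τ
    exact ⟨hA.differentiableAt, (lowering_eq hA).trans h⟩
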